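/- Let $n\ge 2$, $N\ge1$, $L_n=\{0,1,\dots,n-1\}$, $L_n^0=\{1,\dots,n-1\}$, $\mu\in\mathbb C$, and let $A_{ij}=A_{ji}\in M(N,\mathbb C)$ $(i,j\in L_n)$, $A_{ii}=0$, be the residue matrices of a KZ-type equation $\mathcal M:\ \partial u/\partial x_i=\sum_{\nu\ne i}\frac{A_{i\nu}}{x_i-x_\nu}u$, i.e. $[A_{ij},A_{k\ell}]=0$ and $[A_{ij},A_{ik}+A_{jk}]=0$ for distinct $i,j,k,\ell$. For $I\subset L_n$ put $A_I=\sum_{i<j,\ i,j\in I}A_{ij}$ (so $A_\emptyset=A_{\{i\}}=0$), and put $A_{0\infty}=-\sum_{j\in L_n^0}A_{0j}$. *Convolution.* Write $\mathbb C^{(n-1)N}=\bigoplus_{j=1}^{n-1}\iota_j(\mathbb C^N)$. The convolution $\widetilde{\mathrm{mc}}_{x_0,\mu}\mathcal M$ has the residue matrices $\tilde A_{ij}=\tilde A_{ji}$ of size $(n-1)N$, where: $\tilde A_{0k}$ has $k$-th block row $(A_{01},\dots,A_{0k}+\mu,\dots,A_{0,n-1})$ and zeros elsewhere; for distinct $i,j\in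 L_n^0$, $\tilde A_{ij}$ is the block diagonal matrix with all diagonal blocks $A_{ij}$, to which $A_{0j},-A_{0j},-A_{0i},A_{0i}$ are added at the block places $(i,i),(i,j),(j,i),(j,j)$. Define $\tilde A_I$ and $\tilde A_{0\infty}$ from the $\tilde A_{ij}$ as above. Put $\mathcal K_j=\iota_j(\ker A_{0j})$ $(j\in L_n^0)$, $\mathcal K_\infty=\ker\tilde A_{0\infty}$, $\mathcal K=\mathcal K_\infty+\sum_j\mathcal K_j$. The middle convolution $\mathrm{mc}_{x_0,\mu}\mathcal M$ is induced by the $\tilde A_{ij}$ on $\mathbb C^{(n-1)N}/\mathcal K$; write $\bar A_I$ for the map induced by $\tilde A_I$. *Commuting families.* A commuting family of $L_n$ is a set of subsets of $L_n$ with more than one element, any two of which are disjoint or nested. Let $\mathcal I$ be a maximal one (it corresponds to a single-elimination tournament of the teams $0,\dots,n-1$, whose games are the members of $\mathcal I$). Let $I_{1,0}\subsetneq\dots\subsetneq I_{r,0}$ be the members of $\mathcal I$ containing $0$ and put $I_{0,0}=\{0\}$; order $\mathcal I$ as $I^{(1)}<\dots<I^{(n-1)}$ so that, for $k=1,2,\dots,r$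 in turn, first $I_{k,0}$ and then all members of $\mathcal I$ contained in $I_{k,0}\setminus I_{k-1,0}$ are listed, where among the latter no set comes before a set properly containing it. For $I\in\mathcal I$ let $b^0(I)\not\ni0$ be one of the two disjoint sets, each a member of $\mathcal I$ or a singleton, whose union is $I$. For nonempty $I,K\subset L_n$ put $\mathrm{md}_{0,K}(I)=I\cup\{0\}$ if $I\supset K$ and $I\setminus\{0\}$ otherwise; $\mathrm{me}_{0,K}(I)=1$ if $0\in I\supset K$ and $0$ otherwise; and $$A_I^K=A_{\mathrm{md}_{0,K}(I)}+\mathrm{me}_{0,K}(I)\,\mu .$$ *Spectra.* For commuting matrices, $[B_1:\cdots:B_k]=\{[\lambda_{1,s}:\cdots:\lambda_{k,s}]_{m_s}\}_s$ denotes their simultaneous (generalized) eigenvalues with multiplicities, written, possibly with repeated tuples, so that $\prod_s(B_i-\lambda_{i,s})=0$ for each $i$; $[\cdot]_p$ means that all multiplicities are multiplied by $p$ (the term is omitted if $p=0$); $\sqcup$ is the disjoint union; $|_V$ is restriction to an invariant subspace $V$. An equality with a union on the right means that the multiplicities agree and that every such way of writing the terms on the right gives one for the left. **Theorem.** The families of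 matrices below commute, the subspaces below are invariant, and the following hold. (i) For $I\in\mathcal I$, with $\varepsilon_I=1$ if $0\in I$ and $\varepsilon_I=0$ if $0\notin I$, $$[\tilde A_I]=[A_{I\cup\{0\}}+\varepsilon_I\mu]_{|I|-1}\sqcup[A_{I\setminus\{0\}}]_{n-|I|}.$$ (ii) $$[\tilde A_{I^{(1)}}:\cdots:\tilde A_{I^{(n-1)}}]=\bigsqcup_{J\in\mathcal I}[A^J_{I^{(1)}}:\cdots:A^J_{I^{(n-1)}}],$$ $$[\tilde A_{I^{(1)}}:\cdots:\tilde A_{I^{(n-1)}}]|_{\mathcal K_j}=[A^{\{j\}}_{I^{(1)}}:\cdots:A^{\{j\}}_{I^{(n-1)}}]|_{\ker A_{0j}}\quad(j\in L_n^0),$$ $$[\tilde A_{I^{(1)}}:\cdots:\tilde A_{I^{(n-1)}}]|_{\mathcal K_\infty}=[A^{L_n}_{I^{(1)}}:\cdots:A^{L_n}_{I^{(n-1)}}]|_{\ker(A_{0\infty}-\mu)}\quad\text{if }\mu\ne0.$$ (iii) Let $U=U_{b^0(\mathcal I)}$ be the matrix of $N\times N$ blocks, with rows $j$ and columns $i$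 in $\{1,\dots,n-1\}$, whose block at the place $(j,i)$ is the identity matrix if $j\in b^0(I^{(i)})$ and zero otherwise. Then $U$ is invertible and all $U^{-1}\tilde A_{I^{(i)}}U$ are block upper triangular. (iv) If $\mu\ne0$, the multiplicity of each tuple in the simultaneous spectrum $[\bar A_{I^{(1)}}:\cdots:\bar A_{I^{(n-1)}}]$ of the middle convolution is its multiplicity in $\bigsqcup_{J\in\mathcal I}[A^J_{I^{(1)}}:\cdots:A^J_{I^{(n-1)}}]$ minus the sum of its multiplicities in $[A^{\{j\}}_{I^{(1)}}:\cdots:A^{\{j\}}_{I^{(n-1)}}]|_{\ker A_{0j}}$ $(j\in L_n^0)$ and in $[A^{L_n}_{I^{(1)}}:\cdots:A^{L_n}_{I^{(n-1)}}]|_{\ker(A_{0\infty}-\mu)}$. (v) Let $J\in\mathcal I$ or $J=\{j\}$ with $j\in L_n^0$. Delete team $0$ from the tournament $\mathcal I$ (replace each $I\in\mathcal I$ by $I\setminus\{0\}$ and drop singletons), then insert team $0$ again, with its first game played against the winner of $J\setminus\{0\}$ (keep the sets not properly containing $J\setminus\{0\}$, adjoin $0$ to those properly containing it, and add the set $J\cup\{0\}$).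 The result is again a maximal commuting family of $L_n$, and it consists of the sets with more than one element among $\mathrm{md}_{0,J}(I)$ $(I\in\mathcal I)$, $J\cup\{0\}$ and $J\setminus\{0\}$. -/

import Mathlib

noncomputable section

namespace KZ

/-! ### Commuting families of subsets and tournaments

Throughout, `L_n = {0, …, n-1}` is `Fin (m + 1)` with `n = m + 1`, and
`L_n ∖ {0} = {1, …, n-1}` is the set of all `j.succ` with `j : Fin m`. -/

/-- A commuting family: subsets with more than one element, any two of which are disjoint or
nested. -/
def IsCommutingFamily {α : Type*} [DecidableEq α] (F : Finset (Finset α)) : Prop :=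
  (∀ I ∈ F, 1 < I.card) ∧
    ∀ I ∈ F, ∀ J ∈ F, I ≠ J → Disjoint I J ∨ I ⊂ J ∨ J ⊂ I

/-- A maximal commuting family (maximal for inclusion). -/
def IsMaxCommutingFamily {α : Type*} [DecidableEq α] (F : Finset (Finset α)) : Prop :=
  Maximal IsCommutingFamily F

/-- `md_{i,J}(I)`. -/
def md {α : Type*} [DecidableEq α] (i : α) (J I : Finset α) : Finset α :=
  if J ⊆ I then insert i I else I.erase i

/-- `me_{i,J}(I)`. -/
def me {α : Type*} [DecidableEq α] (i : α) (J I : Finset α) : ℕ :=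
  if i ∈ I ∧ J ⊆ I then 1 else 0

/-- For `I` in a maximal commuting family `F`, the number `k - 1`, where
`I_{1,0} ⊂ I_{2,0} ⊂ ⋯ ⊂ I_{r,0}` are the members of `F` containing `0` and `k` is the least index
with `I ⊆ I_{k,0}`. So `level F I = k - 1` says that `I = I_{k,0}` or
`I ⊆ I_{k,0} ∖ I_{k-1,0}` (with `I_{0,0} = {0}`). -/
def level {m : ℕ} (F : Finset (Finset (Fin (m + 1)))) (I : Finset (Fin (m + 1))) : ℕ :=
  (F.filter fun G => 0 ∈ G ∧ ¬ I ⊆ G).card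

/-- `E 0 < E 1 < ⋯ < E (m - 1)` (the paper's `I^{(1)} < ⋯ < I^{(n-1)}`) lists the members of `F`
in an admissible order: by increasing level, and inside one level no set comes before a set that
properly contains it. In particular `I_{k,0}`, which contains all sets of its level, comes first
in its level. -/
structure IsOrdering {m : ℕ} (F : Finset (Finset (Fin (m + 1))))
    (E : Fin m → Finset (Fin (m + 1))) : Prop where
  injective : Function.Injective E
  mem_iff : ∀ I, I ∈ F ↔ ∃ a, E a = I
  ordered : ∀ a b, a < b →
    level F (E a) < level F (E b) ∨
      (level F (E a) = level F (E b) ∧ (E b ⊆ E a ∨ Disjoint (E a) (E b)))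

/-- `I` is a member of `F` or a singleton. -/
def IsNode {α : Type*} [DecidableEq α] (F : Finset (Finset α)) (I : Finset α) : Prop :=
  I ∈ F ∨ ∃ j, I = {j}

/-- `b` is a map `b⁰`: it picks for each game `I ∈ F` the losing one of the two sides whose
disjoint union is `I`, in such a way that `0` never loses. -/
def IsLosingSide {m : ℕ} (F : Finset (Finset (Fin (m + 1))))
    (b : Finset (Fin (m + 1)) → Finset (Fin (m + 1))) : Prop :=
  ∀ I ∈ F, b I ⊆ I ∧ IsNode F (b I) ∧ IsNode F (I \ b I) ∧ 0 ∉ b I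

/-- Deletion of team `i` from a tournament: `i` is removed from all games; its first game
disappears (it becomes the preceding game of the opponent, or a singleton). -/
def deleteTeam {α : Type*} [DecidableEq α] (i : α) (F : Finset (Finset α)) :
    Finset (Finset α) :=
  (F.image fun I => I.erase i).filter fun I => 1 < I.card

/-- Insertion of a new team `i` into a tournament: the first game of `i` is played with the winner
of `J` (a game or a single team), and `i` joins all the later games of that winner. -/
def insertTeam {α : Type*} [DecidableEq α] (i : α) (J : Finset α) (F : Finset (Finset α)) :
    Finset (Finset α) :=
  (F.filter fun I => ¬ J ⊂ I) ∪ ((F.filter fun I => J ⊂ I).image fun I => insert i I) ∪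
    {insert i J}

/-! ### KZ-type equations and the convolution -/

/-- The matrices `A i j` are the residue matrices of a KZ-type equation: `A i j = A j i`, the
convention `A i i = 0`, and the integrability condition. -/
structure IsKZType {m N : ℕ} (A : Fin (m + 1) → Fin (m + 1) → Matrix (Fin N) (Fin N) ℂ) :
    Prop where
  symm : ∀ i j, A i j = A j i
  diag : ∀ i, A i i = 0
  comm_disjoint : ∀ i j k l, i ≠ j → i ≠ k → i ≠ l → j ≠ k → j ≠ l → k ≠ l →
    Commute (A i j) (A k l)
  comm_triple : ∀ i j k, i ≠ j → i ≠ k → j ≠ k → Commute (A i j) (A i k + A j k)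

/-- The generalized residue matrix `A_I`, the sum of `A i j` over the pairs `i < j` in `I`;
it is `0` for `|I| ≤ 1`. -/
def residue {m : ℕ} {ι : Type*} (A : Fin (m + 1) → Fin (m + 1) → Matrix ι ι ℂ)
    (I : Finset (Fin (m + 1))) : Matrix ι ι ℂ :=
  ∑ i ∈ I, ∑ j ∈ I with i < j, A i j

/-- The residue matrix at infinity `A_{i∞} = -(A_{i0} + ⋯ + A_{i,n-1})`. -/
def residueInfty {m : ℕ} {ι : Type*} (A : Fin (m + 1) → Fin (m + 1) → Matrix ι ι ℂ)
    (i : Fin (m + 1)) : Matrix ι ι ℂ :=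
  -∑ j, A i j

/-- The blocks of `Ã_{0k}`, with `k` standing for `k.succ`: only row `k` is nonzero, with entries
`A_{01}, …, A_{0k} + μ, …, A_{0,n-1}`. -/
def convZeroBlock {m N : ℕ} (A : Fin (m + 1) → Fin (m + 1) → Matrix (Fin N) (Fin N) ℂ) (μ : ℂ)
    (k : Fin m) : Matrix (Fin m) (Fin m) (Matrix (Fin N) (Fin N) ℂ) :=
  Matrix.of fun r c =>
    if r = k then A 0 c.succ + (if c = k then μ • (1 : Matrix (Fin N) (Fin N) ℂ) else 0) else 0

/-- The blocks of `Ã_{ij}` for distinct `i`, `j` in `{1, …, n-1}`, with `i`, `j` standing for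
`i.succ`, `j.succ`: `A_{ij}` on the diagonal, plus `A_{0j}, -A_{0j}, -A_{0i}, A_{0i}` at the places
`(i,i), (i,j), (j,i), (j,j)`. -/
def convPairBlock {m N : ℕ} (A : Fin (m + 1) → Fin (m + 1) → Matrix (Fin N) (Fin N) ℂ)
    (i j : Fin m) : Matrix (Fin m) (Fin m) (Matrix (Fin N) (Fin N) ℂ) :=
  Matrix.of fun r c =>
    (if r = c then A i.succ j.succ else 0) +
      (if r = i ∧ c = i then A 0 j.succ else 0) -
      (if r = i ∧ c = j then A 0 j.succ else 0) -
      (if r = j ∧ c = i then A 0 i.succ else 0) +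
      (if r = j ∧ c = j then A 0 i.succ else 0)

/-- The residue matrices `Ã_{ij}`, of size `(n-1)N`, of the convolution with parameter `μ` in the
variable `x_0`. -/
def conv {m N : ℕ} (A : Fin (m + 1) → Fin (m + 1) → Matrix (Fin N) (Fin N) ℂ) (μ : ℂ)
    (i j : Fin (m + 1)) : Matrix (Fin m × Fin N) (Fin m × Fin N) ℂ :=
  Matrix.comp (Fin m) (Fin m) (Fin N) (Fin N) ℂ
    (Fin.cases (motive := fun _ => Matrix (Fin m) (Fin m) (Matrix (Fin N) (Fin N) ℂ))
      (Fin.cases (motive := fun _ => Matrix (Fin m) (Fin m) (Matrix (Fin N) (Fin N) ℂ))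
        0 (fun k => convZeroBlock A μ k) j)
      (fun a =>
        Fin.cases (motive := fun _ => Matrix (Fin m) (Fin m) (Matrix (Fin N) (Fin N) ℂ))
          (convZeroBlock A μ a) (fun b => if a = b then 0 else convPairBlock A a b) j)
      i)

/-- `A_I^K = A_{md_{0,K}(I)} + me_{0,K}(I) μ`. -/
def shifted {m N : ℕ} (A : Fin (m + 1) → Fin (m + 1) → Matrix (Fin N) (Fin N) ℂ) (μ : ℂ)
    (K I : Finset (Fin (m + 1))) : Matrix (Fin N) (Fin N) ℂ :=
  residue A (md 0 K I) + ((me 0 K I : ℂ) * μ) • (1 : Matrix (Fin N) (Fin N) ℂ)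

/-- The embedding `ι_j : ℂ^N → ℂ^{(n-1)N}` as the `j`-th block. -/
def iota {m N : ℕ} (j : Fin m) : (Fin N → ℂ) →ₗ[ℂ] (Fin m × Fin N → ℂ) where
  toFun v := fun p => if p.1 = j then v p.2 else 0
  map_add' v w := by ext p; by_cases h : p.1 = j <;> simp [h]
  map_smul' c v := by ext p; by_cases h : p.1 = j <;> simp [h]

/-- `ker A_{0j}`, with `j` standing for `j.succ`. -/
def kerZero {m N : ℕ} (A : Fin (m + 1) → Fin (m + 1) → Matrix (Fin N) (Fin N) ℂ) (j : Fin m) :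
    Submodule ℂ (Fin N → ℂ) :=
  LinearMap.ker (Matrix.toLin' (A 0 j.succ))

/-- `ker (A_{0∞} - μ)`. -/
def kerInfty {m N : ℕ} (A : Fin (m + 1) → Fin (m + 1) → Matrix (Fin N) (Fin N) ℂ) (μ : ℂ) :
    Submodule ℂ (Fin N → ℂ) :=
  LinearMap.ker (Matrix.toLin' (residueInfty A 0 - μ • (1 : Matrix (Fin N) (Fin N) ℂ)))

/-- `𝒦_j = ι_j (ker A_{0j})`, with `j` standing for `j.succ`. -/
def KSub {m N : ℕ} (A : Fin (m + 1) → Fin (m + 1) → Matrix (Fin N) (Fin N) ℂ) (j : Fin m) :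
    Submodule ℂ (Fin m × Fin N → ℂ) :=
  (kerZero A j).map (iota j)

/-- `𝒦_∞ = ker Ã_{0∞}`. -/
def KInfty {m N : ℕ} (A : Fin (m + 1) → Fin (m + 1) → Matrix (Fin N) (Fin N) ℂ) (μ : ℂ) :
    Submodule ℂ (Fin m × Fin N → ℂ) :=
  LinearMap.ker (Matrix.toLin' (residueInfty (conv A μ) 0))

/-- `𝒦 = 𝒦_∞ + 𝒦_1 + ⋯ + 𝒦_{n-1}`; the middle convolution is the system induced by the
convolution on the quotient of `ℂ^{(n-1)N}` by `𝒦`. -/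
def KTotal {m N : ℕ} (A : Fin (m + 1) → Fin (m + 1) → Matrix (Fin N) (Fin N) ℂ) (μ : ℂ) :
    Submodule ℂ (Fin m × Fin N → ℂ) :=
  KInfty A μ ⊔ ⨆ j, KSub A j

/-- The block matrix `U` whose `a`-th block column is `ι_{b(E a)}`: the block at the place
`(j, a)` is the identity if `j ∈ b (E a)` and zero otherwise. -/
def basisChange {m : ℕ} (N : ℕ) (E : Fin m → Finset (Fin (m + 1)))
    (b : Finset (Fin (m + 1)) → Finset (Fin (m + 1))) :
    Matrix (Fin m × Fin N) (Fin m × Fin N) ℂ :=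
  Matrix.comp (Fin m) (Fin m) (Fin N) (Fin N) ℂ
    (Matrix.of fun j a => if j.succ ∈ b (E a) then (1 : Matrix (Fin N) (Fin N) ℂ) else 0)

/-! ### Simultaneous spectra -/

section Spectra

variable {ι V W : Type*} [AddCommGroup V] [Module ℂ V] [AddCommGroup W] [Module ℂ W]

/-- The simultaneous eigenvalues of the family `B` with their multiplicities: the tuple `z` has
as multiplicity the dimension of its simultaneous generalized eigenspace. Disjoint union of
spectra is addition of these functions. -/
def simSpec (B : ι → Module.End ℂ V) (z : ι → ℂ) : ℕ :=
  Module.finrank ℂ (⨅ i, (B i).maxGenEigenspace (z i) : Submodule ℂ V)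

/-- The list `S` of pairs `([λ_{1,k} : λ_{2,k} : ⋯], m_k)` is an admissible way to write the
simultaneous spectrum `{[λ_{1,k} : λ_{2,k} : ⋯]_{m_k}}_k` of `B`: the `m_k` are positive, they sum
up to the multiplicity for each tuple of eigenvalues, and `∏_k (B_i - λ_{i,k}) = 0` for all `i`.
A tuple may occur more than once in `S`. -/
structure IsSpectrum (B : ι → Module.End ℂ V) (S : Multiset ((ι → ℂ) × ℕ)) : Prop where
  pos : ∀ e ∈ S, 0 < e.2
  mult : ∀ z : ι → ℂ,
    (by classical exact ((S.filter fun e => e.1 = z).map Prod.snd).sum) = simSpec B z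
  annihil : ∀ i, Polynomial.aeval (B i)
    (S.map fun e => (Polynomial.X - Polynomial.C (e.1 i) : Polynomial ℂ)).prod = 0

/-- Multiplication of all multiplicities by `p`, as in the notation `[B]_p`; empty for `p = 0`. -/
def scale (p : ℕ) (S : Multiset ((ι → ℂ) × ℕ)) : Multiset ((ι → ℂ) × ℕ) :=
  if p = 0 then 0 else S.map fun e => (e.1, p * e.2)

/-- `[B] = ⨆_k [C k]_{p k}` (disjoint union) for commuting families `B` and `C k`: the
multiplicities agree, and the union of admissible ways to write the spectra on the right is an
admissible way to write the one on the left. -/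
structure IsSpecUnion {κ : Type*} [Fintype κ] (B : ι → Module.End ℂ V)
    (C : κ → ι → Module.End ℂ W) (p : κ → ℕ) : Prop where
  comm_left : ∀ i j, Commute (B i) (B j)
  comm_right : ∀ k i j, Commute (C k i) (C k j)
  mult : ∀ z, simSpec B z = ∑ k, p k * simSpec (C k) z
  blocks : ∀ S : κ → Multiset ((ι → ℂ) × ℕ), (∀ k, IsSpectrum (C k) (S k)) →
    IsSpectrum B (∑ k, scale (p k) (S k))

/-- The subspace `P` is invariant under all members of `B`. -/
def IsInvariant (B : ι → Module.End ℂ V) (P : Submodule ℂ V) : Prop :=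
  ∀ i, ∀ x ∈ P, B i x ∈ P

/-- The restrictions of the members of `B` to an invariant subspace. -/
def restrictFamily (B : ι → Module.End ℂ V) (P : Submodule ℂ V) (h : IsInvariant B P) :
    ι → Module.End ℂ P :=
  fun i => (B i).restrict (h i)

/-- The maps induced by the members of `B` on the quotient by an invariant subspace. -/
def quotientFamily (B : ι → Module.End ℂ V) (P : Submodule ℂ V) (h : IsInvariant B P) :
    ι → Module.End ℂ (V ⧸ P) :=
  fun i => P.mapQ P (B i) (h i)

/-- `[B]|_P = [C]|_Q`: the subspaces are invariant, the restricted families commute, and they have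
the same simultaneous spectrum. -/
def SameSpectrumOn (B : ι → Module.End ℂ V) (P : Submodule ℂ V) (C : ι → Module.End ℂ W)
    (Q : Submodule ℂ W) : Prop :=
  ∃ (hP : IsInvariant B P) (hQ : IsInvariant C Q),
    (∀ i j, Commute (restrictFamily B P hP i) (restrictFamily B P hP j)) ∧
    (∀ i j, Commute (restrictFamily C Q hQ i) (restrictFamily C Q hQ j)) ∧
    (∀ z, simSpec (restrictFamily B P hP) z = simSpec (restrictFamily C Q hQ) z) ∧
    ∀ S, IsSpectrum (restrictFamily B P hP) S ↔ IsSpectrum (restrictFamily C Q hQ) S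

end Spectra

/-- The family `(Ã_{I^{(1)}}, …, Ã_{I^{(n-1)}})`, acting on `ℂ^{(n-1)N}`. -/
def convFamily {m N : ℕ} (A : Fin (m + 1) → Fin (m + 1) → Matrix (Fin N) (Fin N) ℂ) (μ : ℂ)
    (E : Fin m → Finset (Fin (m + 1))) : Fin m → Module.End ℂ (Fin m × Fin N → ℂ) :=
  fun a => Matrix.toLin' (residue (conv A μ) (E a))

/-- The family `(A^K_{I^{(1)}}, …, A^K_{I^{(n-1)}})`, acting on `ℂ^N`. -/
def shiftedFamily {m N : ℕ} (A : Fin (m + 1) → Fin (m + 1) → Matrix (Fin N) (Fin N) ℂ) (μ : ℂ)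
    (E : Fin m → Finset (Fin (m + 1))) (K : Finset (Fin (m + 1))) :
    Fin m → Module.End ℂ (Fin N → ℂ) :=
  fun a => Matrix.toLin' (shifted A μ K (E a))

end KZ

end

/-!
Write `V = ℂ^N` and identify `ℂ^{(n-1)N}` with tuples `(w_r)` of vectors of `V`, where `r` runs
through `{1, …, n-1}`. Everything rests on one formula for the generalized residue matrices of the
convolution (`KZ.curry_residue_conv`): in a row `r ∈ I` the matrix `Ã_I` acts by
`A_{I ∪ {0}} + ε_I μ` up to a vector `σ_I(w)` that does not depend on `r`, and in the other rows it
acts by `A_{I ∖ {0}}`. Here `σ_I(w)` is `∑_{j ∉ I} A_{0j} w_j` if `0 ∈ I` and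
`-∑_{j ∈ I} A_{0j} w_j` otherwise. The two diagonal matrices are just the possible values of
`A_I^K`, according to whether `K ⊆ I` or not (`KZ.toLin'_shifted`).

*Commutation.* The sums `∑_{j ∈ X} A_{0j} w_j` intertwine `Ã_I` with `A_{I ∖ {0}}` for suitable `X`
(`KZ.IsKZType.sumZero_convEnd`). Together with the commutation of the `A_I` for nested or disjoint
sets, which follows from the integrability condition, this shows that the `Ã_I` of nested or
disjoint sets commute.

*A single matrix.* If `0 ∈ I`, the tuples supported in the rows `r ∈ I` form an invariant subspace;
if `0 ∉ I`, those constant in these rows do. The matrix acts diagonally on the subspace and on the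
quotient.

*The family.* In a maximal commuting family every game has two sides
(`KZ.IsMaxCommutingFamily.exists_split`). Let `ι_S = ∑_{j ∈ S} ι_j`, and let `b(K)` be the side of
the game `K` that loses. Then `Ã_I ι_{b(K)}(v)` equals `ι_{b(K)}(A_I^K v)` up to a vector in the
image of `ι_{I ∖ {0}}`, which is nonzero only if `K ⊆ I ∌ 0` or if `0 ∈ I` and `I` is disjoint from
`b(K)`. In both cases `ι_{I ∖ {0}}` is a combination of the `ι_{b(Q)}` with `Q` before `K` in the
admissible order (`KZ.IsLosingSide.convEnd_tupleOn_sub_mem`). Hence the images of the `ι_{b(K)}`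
give a flag on whose subquotients the family acts by the `A_I^K`. They span the whole space,
because every single team is a node, so the matrix `U` is invertible by counting dimensions.

*Spectra.* Simultaneous generalized eigenspaces of commuting families lift along equivariant
surjections (`KZ.exists_simEig_lift`), so that multiplicities are additive in exact sequences
(`KZ.simSpec_add_of_exact`), while annihilating polynomials multiply. This gives the spectrum of the
family from the flag. The kernels are handled by equivariant embeddings of `ker A_{0j}` and of
`ker (A_{0∞} - μ)`, whose images are independent for `μ ≠ 0` (`KZ.kernelSum_injective`), so that the
spectrum of the middle convolution follows by subtraction.

*Tournaments.* A commuting family is maximal if and only if it contains the whole set and each of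
its members has two sides (`KZ.IsCommutingFamily.isMax_of_split`). The sides of the games after
moving team `0` are read off from those before, once games whose only purpose is to add team `0` to
an existing game are replaced by the latter (`KZ.IsMaxCommutingFamily.exists_split_erase`).
-/

noncomputable section

namespace KZ

open scoped Matrix

/-! ### Simultaneous spectra in exact sequences -/

section Spectral

open Module

variable {ι V₁ V₂ V₃ : Type*} [AddCommGroup V₁] [Module ℂ V₁] [AddCommGroup V₂] [Module ℂ V₂]
  [AddCommGroup V₃] [Module ℂ V₃]

theorem aeval_intertwine {B₁ : End ℂ V₁} {B₂ : End ℂ V₂} {f : V₁ →ₗ[ℂ] V₂}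
    (h : ∀ x, B₂ (f x) = f (B₁ x)) (p : Polynomial ℂ) (x : V₁) :
    Polynomial.aeval B₂ p (f x) = f (Polynomial.aeval B₁ p x) := by
  induction p using Polynomial.induction_on generalizing x with
  | C a => simp [Polynomial.aeval_C, Module.algebraMap_end_apply]
  | add p q hp hq => simp [hp, hq]
  | monomial n a ih =>
    rw [pow_succ, ← mul_assoc, map_mul (Polynomial.aeval B₂) _ Polynomial.X,
      map_mul (Polynomial.aeval B₁) _ Polynomial.X, Polynomial.aeval_X, Polynomial.aeval_X,
      Module.End.mul_apply, Module.End.mul_apply, h, ih]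

theorem commute_of_injective {B₁ C₁ : End ℂ V₁} {B₂ C₂ : End ℂ V₂} {f : V₁ →ₗ[ℂ] V₂}
    (hf : Function.Injective f) (hB : ∀ x, B₂ (f x) = f (B₁ x))
    (hC : ∀ x, C₂ (f x) = f (C₁ x)) (h : Commute B₂ C₂) : Commute B₁ C₁ := by
  refine LinearMap.ext fun x => hf ?_
  simp only [Module.End.mul_apply, ← hB, ← hC]
  exact LinearMap.congr_fun h.eq (f x)

theorem commute_of_surjective {B₁ C₁ : End ℂ V₁} {B₂ C₂ : End ℂ V₂} {f : V₁ →ₗ[ℂ] V₂}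
    (hf : Function.Surjective f) (hB : ∀ x, B₂ (f x) = f (B₁ x))
    (hC : ∀ x, C₂ (f x) = f (C₁ x)) (h : Commute B₁ C₁) : Commute B₂ C₂ := by
  refine LinearMap.ext fun y => ?_
  obtain ⟨x, rfl⟩ := hf y
  simp only [Module.End.mul_apply, hB, hC]
  exact congrArg f (LinearMap.congr_fun h.eq x)

theorem sub_smul_pow_intertwine {B₁ : End ℂ V₁} {B₂ : End ℂ V₂} {f : V₁ →ₗ[ℂ] V₂}
    (h : ∀ x, B₂ (f x) = f (B₁ x)) (z : ℂ) (k : ℕ) (x : V₁) :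
    ((B₂ - z • (1 : End ℂ V₂)) ^ k) (f x) = f (((B₁ - z • (1 : End ℂ V₁)) ^ k) x) := by
  have h' : (B₂ - z • (1 : End ℂ V₂)).comp f = f.comp (B₁ - z • (1 : End ℂ V₁)) := by
    ext x; simp [h]
  exact LinearMap.congr_fun (Module.End.commute_pow_left_of_commute h' k) x

theorem map_mem_simEig {B₁ : ι → End ℂ V₁} {B₂ : ι → End ℂ V₂} {f : V₁ →ₗ[ℂ] V₂}
    (h : ∀ i x, B₂ i (f x) = f (B₁ i x)) {z : ι → ℂ} {x : V₁}
    (hx : x ∈ ⨅ i, (B₁ i).maxGenEigenspace (z i)) :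
    f x ∈ ⨅ i, (B₂ i).maxGenEigenspace (z i) := by
  rw [Module.End.mem_iInf_maxGenEigenspace_iff] at hx ⊢
  intro j
  obtain ⟨k, hk⟩ := hx j
  exact ⟨k, by rw [sub_smul_pow_intertwine (h j), hk, map_zero]⟩

theorem mem_simEig_of_map {B₁ : ι → End ℂ V₁} {B₂ : ι → End ℂ V₂} {f : V₁ →ₗ[ℂ] V₂}
    (h : ∀ i x, B₂ i (f x) = f (B₁ i x)) (hf : Function.Injective f) {z : ι → ℂ} {x : V₁}
    (hx : f x ∈ ⨅ i, (B₂ i).maxGenEigenspace (z i)) :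
    x ∈ ⨅ i, (B₁ i).maxGenEigenspace (z i) := by
  rw [Module.End.mem_iInf_maxGenEigenspace_iff] at hx ⊢
  intro j
  obtain ⟨k, hk⟩ := hx j
  exact ⟨k, hf (by rw [← sub_smul_pow_intertwine (h j), hk, map_zero])⟩

theorem iSup_simEig_eq_top [FiniteDimensional ℂ V₁] {B : ι → End ℂ V₁}
    (hc : ∀ i j, Commute (B i) (B j)) :
    ⨆ z : ι → ℂ, ⨅ i, (B i).maxGenEigenspace (z i) = ⊤ :=
  Module.End.iSup_iInf_maxGenEigenspace_eq_top_of_iSup_maxGenEigenspace_eq_top_of_commute B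
    (fun i j _ => hc i j) fun i => Module.End.iSup_maxGenEigenspace_eq_top (B i)

theorem iSupIndep_simEig {B : ι → End ℂ V₁} (hc : ∀ i j, Commute (B i) (B j)) :
    iSupIndep fun z : ι → ℂ => ⨅ i, (B i).maxGenEigenspace (z i) :=
  Module.End.independent_iInf_maxGenEigenspace_of_forall_mapsTo B
    fun i j _ => Module.End.mapsTo_maxGenEigenspace_of_comm (hc j i) _

/-- Under an equivariant surjection of commuting families, simultaneous generalized eigenvectors
lift: decompose any lift along the simultaneous generalized eigenspaces and keep the component of
the given eigenvalue, since the other components cancel downstairs by independence. -/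
theorem exists_simEig_lift [FiniteDimensional ℂ V₂] {B₂ : ι → End ℂ V₂} {B₃ : ι → End ℂ V₃}
    (hc : ∀ i j, Commute (B₂ i) (B₂ j)) {g : V₂ →ₗ[ℂ] V₃} (hg : Function.Surjective g)
    (h : ∀ i x, B₃ i (g x) = g (B₂ i x)) {z : ι → ℂ} {y : V₃}
    (hy : y ∈ ⨅ i, (B₃ i).maxGenEigenspace (z i)) :
    ∃ x ∈ ⨅ i, (B₂ i).maxGenEigenspace (z i), g x = y := by
  have hc3 : ∀ i j, Commute (B₃ i) (B₃ j) := fun i j =>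
    commute_of_surjective hg (h i) (h j) (hc i j)
  obtain ⟨x, rfl⟩ := hg y
  have hx : x ∈ (⨅ i, (B₂ i).maxGenEigenspace (z i)) ⊔
      ⨆ w, ⨆ (_ : w ≠ z), ⨅ i, (B₂ i).maxGenEigenspace (w i) := by
    have h1 := iSup_simEig_eq_top hc
    have h2 : (⊤ : Submodule ℂ V₂) ≤ (⨅ i, (B₂ i).maxGenEigenspace (z i)) ⊔
      ⨆ w, ⨆ (_ : w ≠ z), ⨅ i, (B₂ i).maxGenEigenspace (w i) := by
      rw [← h1]
      refine iSup_le fun w => ?_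
      by_cases hw : w = z
      · subst hw; exact le_sup_left
      · exact le_sup_of_le_right (le_iSup₂_of_le w hw le_rfl)
    exact h2 trivial
  obtain ⟨a, ha, b, hb, rfl⟩ := Submodule.mem_sup.mp hx
  refine ⟨a, ha, ?_⟩
  have hgb : g b ∈ ⨆ w, ⨆ (_ : w ≠ z), ⨅ i, (B₃ i).maxGenEigenspace (w i) := by
    have : (⨆ w, ⨆ (_ : w ≠ z), ⨅ i, (B₂ i).maxGenEigenspace (w i)) ≤
        (⨆ w, ⨆ (_ : w ≠ z), ⨅ i, (B₃ i).maxGenEigenspace (w i)).comap g := by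
      refine iSup₂_le fun w hw x hx => ?_
      exact (le_iSup₂_of_le (f := fun w (_ : w ≠ z) => ⨅ i, (B₃ i).maxGenEigenspace (w i))
        w hw le_rfl) (map_mem_simEig h hx)
    exact this hb
  have hgb' : g b ∈ ⨅ i, (B₃ i).maxGenEigenspace (z i) := by
    have h3 : g b = g (a + b) - g a := by simp
    rw [h3]
    exact Submodule.sub_mem _ hy (map_mem_simEig h ha)
  have := Submodule.disjoint_def.mp (iSupIndep_simEig hc3 z) _ hgb' hgb
  simp [this]

/-- Simultaneous spectra are additive in equivariant short exact sequences. -/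
theorem simSpec_add_of_exact [FiniteDimensional ℂ V₂]
    {B₁ : ι → End ℂ V₁} {B₂ : ι → End ℂ V₂} {B₃ : ι → End ℂ V₃}
    (hc : ∀ i j, Commute (B₂ i) (B₂ j)) {f : V₁ →ₗ[ℂ] V₂} {g : V₂ →ₗ[ℂ] V₃}
    (hf : Function.Injective f) (hg : Function.Surjective g)
    (hfg : ∀ y, g y = 0 ↔ ∃ x, f x = y)
    (h₁ : ∀ i x, B₂ i (f x) = f (B₁ i x)) (h₂ : ∀ i x, B₃ i (g x) = g (B₂ i x)) (z : ι → ℂ) :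
    simSpec B₂ z = simSpec B₁ z + simSpec B₃ z := by
  unfold simSpec
  set G₁ := ⨅ i, (B₁ i).maxGenEigenspace (z i)
  set G₂ := ⨅ i, (B₂ i).maxGenEigenspace (z i) with hG₂
  set G₃ := ⨅ i, (B₃ i).maxGenEigenspace (z i)
  have hr : LinearMap.range (g.domRestrict G₂) = G₃ := by
    apply le_antisymm
    · rintro _ ⟨x, rfl⟩
      exact map_mem_simEig h₂ x.2
    · intro y hy
      obtain ⟨x, hx, rfl⟩ := exists_simEig_lift hc hg h₂ hy
      exact ⟨⟨x, hx⟩, rfl⟩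
  have hk : (LinearMap.ker (g.domRestrict G₂)).map G₂.subtype = G₁.map f := by
    apply le_antisymm
    · rintro _ ⟨x, hx, rfl⟩
      obtain ⟨y, hy⟩ := (hfg _).1 (show g x = 0 from hx)
      exact ⟨y, mem_simEig_of_map h₁ hf (by rw [hy]; exact x.2), hy⟩
    · rintro _ ⟨x, hx, rfl⟩
      exact ⟨⟨f x, map_mem_simEig h₁ hx⟩, (hfg _).2 ⟨x, rfl⟩, rfl⟩
  have e1 := LinearMap.finrank_range_add_finrank_ker (g.domRestrict G₂)
  rw [hr] at e1
  have e2 : finrank ℂ (LinearMap.ker (g.domRestrict G₂)) = finrank ℂ G₁ := by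
    rw [(Submodule.equivMapOfInjective f hf G₁).finrank_eq, ← hk,
      (Submodule.equivMapOfInjective _ G₂.injective_subtype _).finrank_eq]
  omega

theorem simSpec_eq_of_equiv {B₁ : ι → End ℂ V₁} {B₂ : ι → End ℂ V₂} (e : V₁ ≃ₗ[ℂ] V₂)
    (h : ∀ i x, B₂ i (e x) = e (B₁ i x)) (z : ι → ℂ) : simSpec B₁ z = simSpec B₂ z := by
  unfold simSpec
  have : (⨅ i, (B₁ i).maxGenEigenspace (z i)).map (e : V₁ →ₗ[ℂ] V₂) =
      ⨅ i, (B₂ i).maxGenEigenspace (z i) := by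
    apply le_antisymm
    · rintro _ ⟨x, hx, rfl⟩
      exact map_mem_simEig (f := (e : V₁ →ₗ[ℂ] V₂)) h hx
    · intro y hy
      obtain ⟨x, rfl⟩ := e.surjective y
      exact ⟨x, mem_simEig_of_map (f := (e : V₁ →ₗ[ℂ] V₂)) h e.injective hy, rfl⟩
  rw [← this]
  exact (LinearEquiv.finrank_map_eq e _).symm

theorem aeval_eq_zero_iff_of_equiv {B₁ : End ℂ V₁} {B₂ : End ℂ V₂} (e : V₁ ≃ₗ[ℂ] V₂)
    (h : ∀ x, B₂ (e x) = e (B₁ x)) (p : Polynomial ℂ) :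
    Polynomial.aeval B₁ p = 0 ↔ Polynomial.aeval B₂ p = 0 := by
  have h' := aeval_intertwine (f := (e : V₁ →ₗ[ℂ] V₂)) h p
  constructor
  · intro h0
    ext y
    obtain ⟨x, rfl⟩ := e.surjective y
    simpa [h0] using h' x
  · intro h0
    ext x
    apply e.injective
    simpa [h0] using (h' x).symm

theorem isSpectrum_iff_of_equiv {B₁ : ι → End ℂ V₁} {B₂ : ι → End ℂ V₂} (e : V₁ ≃ₗ[ℂ] V₂)
    (h : ∀ i x, B₂ i (e x) = e (B₁ i x)) (S : Multiset ((ι → ℂ) × ℕ)) :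
    IsSpectrum B₁ S ↔ IsSpectrum B₂ S := by
  constructor
  · rintro ⟨h1, h2, h3⟩
    exact ⟨h1, fun z => (h2 z).trans (simSpec_eq_of_equiv e h z),
      fun i => (aeval_eq_zero_iff_of_equiv e (h i) _).1 (h3 i)⟩
  · rintro ⟨h1, h2, h3⟩
    exact ⟨h1, fun z => (h2 z).trans (simSpec_eq_of_equiv e h z).symm,
      fun i => (aeval_eq_zero_iff_of_equiv e (h i) _).2 (h3 i)⟩

theorem aeval_mul_eq_zero_of_exact {B₁ : End ℂ V₁} {B₂ : End ℂ V₂} {B₃ : End ℂ V₃}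
    {f : V₁ →ₗ[ℂ] V₂} {g : V₂ →ₗ[ℂ] V₃} (hfg : ∀ y, g y = 0 → ∃ x, f x = y)
    (h₁ : ∀ x, B₂ (f x) = f (B₁ x)) (h₂ : ∀ x, B₃ (g x) = g (B₂ x)) {p q : Polynomial ℂ}
    (hp : Polynomial.aeval B₁ p = 0) (hq : Polynomial.aeval B₃ q = 0) :
    Polynomial.aeval B₂ (p * q) = 0 := by
  ext y
  rw [map_mul, Module.End.mul_apply]
  obtain ⟨x, hx⟩ := hfg (Polynomial.aeval B₂ q y) (by rw [← aeval_intertwine h₂, hq]; rfl)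
  rw [← hx, aeval_intertwine h₁, hp]
  simp

/-! ### Triangular families on products -/

variable {m : ℕ} {W : Fin m → Type*} [∀ k, AddCommGroup (W k)] [∀ k, Module ℂ (W k)]

/-- The inclusion of the product of the first factors as the tuples whose last entry vanishes. -/
def snocZero {m : ℕ} (W : Fin (m + 1) → Type*) [∀ k, AddCommGroup (W k)] [∀ k, Module ℂ (W k)] :
    (∀ k : Fin m, W k.castSucc) →ₗ[ℂ] (∀ k, W k) where
  toFun w := Fin.snoc (α := W) w 0
  map_add' v w := by
    ext k; induction k using Fin.lastCases <;> simp
  map_smul' c w := by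
    ext k; induction k using Fin.lastCases <;> simp

theorem snocZero_castSucc {m : ℕ} {W : Fin (m + 1) → Type*} [∀ k, AddCommGroup (W k)]
    [∀ k, Module ℂ (W k)] (w : ∀ k : Fin m, W k.castSucc) (k : Fin m) :
    snocZero W w k.castSucc = w k := by
  simp [snocZero]

theorem snocZero_last {m : ℕ} {W : Fin (m + 1) → Type*} [∀ k, AddCommGroup (W k)]
    [∀ k, Module ℂ (W k)] (w : ∀ k : Fin m, W k.castSucc) :
    snocZero W w (Fin.last m) = 0 := by
  simp [snocZero]

theorem snocZero_injective {m : ℕ} (W : Fin (m + 1) → Type*) [∀ k, AddCommGroup (W k)]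
    [∀ k, Module ℂ (W k)] : Function.Injective (snocZero W) := by
  intro v w h
  ext k
  rw [← snocZero_castSucc v, h, snocZero_castSucc]

theorem eq_zero_last_iff {m : ℕ} {W : Fin (m + 1) → Type*} [∀ k, AddCommGroup (W k)]
    [∀ k, Module ℂ (W k)] (y : ∀ k, W k) :
    (LinearMap.proj (R := ℂ) (φ := W) (Fin.last m)) y = 0 ↔ ∃ x, snocZero W x = y := by
  constructor
  · intro h
    refine ⟨fun k => y k.castSucc, ?_⟩
    ext k
    induction k using Fin.lastCases with
    | last => rw [snocZero_last]; exact h.symm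
    | cast k => rw [snocZero_castSucc]
  · rintro ⟨x, rfl⟩
    exact snocZero_last x

/-- The restriction of an endomorphism of a product to the product of the first factors, which is
meaningful if tuples with vanishing last entry are mapped to such tuples. -/
def truncate {m : ℕ} {W : Fin (m + 1) → Type*} [∀ k, AddCommGroup (W k)] [∀ k, Module ℂ (W k)]
    (B : End ℂ (∀ k, W k)) : End ℂ (∀ k : Fin m, W k.castSucc) :=
  (LinearMap.pi fun k : Fin m => LinearMap.proj (R := ℂ) (φ := W) k.castSucc) ∘ₗ B ∘ₗ snocZero W

/-- `B` is upper triangular on a product, with diagonal entries `C k`. -/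
def IsTriangular (B : End ℂ (∀ k, W k)) (C : ∀ k, End ℂ (W k)) : Prop :=
  ∀ w k, (∀ l, k < l → w l = 0) → B w k = C k (w k)

theorem IsTriangular.last {m : ℕ} {W : Fin (m + 1) → Type*} [∀ k, AddCommGroup (W k)]
    [∀ k, Module ℂ (W k)] {B : End ℂ (∀ k, W k)} {C : ∀ k, End ℂ (W k)} (h : IsTriangular B C)
    (w : ∀ k, W k) : B w (Fin.last m) = C (Fin.last m) (w (Fin.last m)) :=
  h w _ fun l hl => absurd hl (not_lt.2 (Fin.le_last l))

theorem IsTriangular.snocZero_truncate {m : ℕ} {W : Fin (m + 1) → Type*}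
    [∀ k, AddCommGroup (W k)] [∀ k, Module ℂ (W k)] {B : End ℂ (∀ k, W k)}
    {C : ∀ k, End ℂ (W k)} (h : IsTriangular B C) (w : ∀ k : Fin m, W k.castSucc) :
    B (snocZero W w) = snocZero W (truncate B w) := by
  ext k
  induction k using Fin.lastCases with
  | last => rw [h.last, snocZero_last, snocZero_last, map_zero]
  | cast k => rw [snocZero_castSucc]; rfl

theorem IsTriangular.truncate {m : ℕ} {W : Fin (m + 1) → Type*} [∀ k, AddCommGroup (W k)]
    [∀ k, Module ℂ (W k)] {B : End ℂ (∀ k, W k)} {C : ∀ k, End ℂ (W k)} (h : IsTriangular B C) :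
    IsTriangular (truncate B) fun k : Fin m => C k.castSucc := by
  intro w k hw
  rw [← snocZero_castSucc w k]
  refine h _ _ fun l hl => ?_
  induction l using Fin.lastCases with
  | last => rw [snocZero_last]
  | cast l => rw [snocZero_castSucc]; exact hw l (by simpa using hl)

theorem simSpec_of_isTriangular {m : ℕ} {W : Fin m → Type*} [∀ k, AddCommGroup (W k)]
    [∀ k, Module ℂ (W k)] [∀ k, FiniteDimensional ℂ (W k)] {B : ι → End ℂ (∀ k, W k)}
    {C : ∀ k, ι → End ℂ (W k)} (hc : ∀ i j, Commute (B i) (B j))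
    (h : ∀ i, IsTriangular (B i) fun k => C k i) (z : ι → ℂ) :
    simSpec B z = ∑ k, simSpec (C k) z := by
  induction m with
  | zero =>
    have hsub : (⨅ i, (B i).maxGenEigenspace (z i)) = ⊥ := Subsingleton.elim _ _
    simp [simSpec, hsub]
  | succ m ih =>
    have hc' : ∀ i j, Commute (truncate (B i)) (truncate (B j)) := fun i j =>
      commute_of_injective (snocZero_injective W) (h i).snocZero_truncate
        (h j).snocZero_truncate (hc i j)
    rw [Fin.sum_univ_castSucc, ← ih hc' fun i => (h i).truncate]
    exact simSpec_add_of_exact hc (snocZero_injective W)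
      (LinearMap.proj_surjective (R := ℂ) (φ := W) (Fin.last m)) eq_zero_last_iff
      (fun i x => (h i).snocZero_truncate x) (fun i x => ((h i).last x).symm) z

theorem aeval_eq_zero_of_isTriangular {m : ℕ} {W : Fin m → Type*} [∀ k, AddCommGroup (W k)]
    [∀ k, Module ℂ (W k)] {B : End ℂ (∀ k, W k)} {C : ∀ k, End ℂ (W k)}
    (h : IsTriangular B C) {P : Fin m → Polynomial ℂ}
    (hP : ∀ k, Polynomial.aeval (C k) (P k) = 0) : Polynomial.aeval B (∏ k, P k) = 0 := by
  induction m with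
  | zero => exact LinearMap.ext fun x => Subsingleton.elim _ _
  | succ m ih =>
    rw [Fin.prod_univ_castSucc]
    exact aeval_mul_eq_zero_of_exact (fun y => (eq_zero_last_iff y).1)
      (fun x => h.snocZero_truncate x) (fun x => (h.last x).symm)
      (ih h.truncate fun k => hP k.castSucc) (hP _)

/-! ### Diagonal actions -/

section Diagonal

variable {V : Type*} [AddCommGroup V] [Module ℂ V]

/-- The diagonal action of an endomorphism on tuples. -/
def diagonalEnd (α : Type*) (C : End ℂ V) : End ℂ (α → V) :=
  LinearMap.pi fun a => C ∘ₗ LinearMap.proj a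

theorem diagonalEnd_apply (α : Type*) (C : End ℂ V) (w : α → V) (a : α) :
    diagonalEnd α C w a = C (w a) := rfl

theorem simSpec_diagonalEnd {α : Type*} [Fintype α] [FiniteDimensional ℂ V] {C : ι → End ℂ V}
    (hc : ∀ i j, Commute (C i) (C j)) (z : ι → ℂ) :
    simSpec (fun i => diagonalEnd α (C i)) z = Fintype.card α * simSpec C z := by
  rw [simSpec_eq_of_equiv (B₂ := fun i => diagonalEnd (Fin (Fintype.card α)) (C i))
    (LinearEquiv.funCongrLeft ℂ V (Fintype.equivFin α).symm) (fun i x => rfl) z,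
    simSpec_of_isTriangular (C := fun _ i => C i) _ (fun i w k _ => rfl) z]
  · simp
  · intro i j
    refine LinearMap.ext fun w => funext fun k => ?_
    exact LinearMap.congr_fun (hc i j) (w k)

theorem aeval_diagonalEnd {α : Type*} {C : End ℂ V} {p : Polynomial ℂ}
    (hp : Polynomial.aeval C p = 0) : Polynomial.aeval (diagonalEnd α C) p = 0 := by
  refine LinearMap.ext fun w => funext fun a => ?_
  have := aeval_intertwine (B₁ := diagonalEnd α C) (B₂ := C)
    (f := LinearMap.proj (R := ℂ) (φ := fun _ : α => V) a) (fun x => rfl) p w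
  rw [hp] at this
  simpa using this.symm

theorem aeval_diagonalEnd_ite {α : Type*} [Fintype α] {C : End ℂ V} {p : Polynomial ℂ}
    (hp : Polynomial.aeval C p = 0) :
    Polynomial.aeval (diagonalEnd α C) (if Fintype.card α = 0 then 1 else p) = 0 := by
  split_ifs with h
  · have := Fintype.card_eq_zero_iff.1 h
    exact LinearMap.ext fun x => Subsingleton.elim _ _
  · exact aeval_diagonalEnd hp

/-- If an endomorphism is an extension of the diagonal actions of `D` on `β`-tuples by that of `C`
on `α`-tuples, then its spectrum consists of `|α|` copies of that of `C` and `|β|` copies of that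
of `D`, and it is annihilated by a product of annihilating polynomials, where those belonging to an
empty set of copies may be left out. -/
theorem spectrum_of_exact_diagonalEnd {α β : Type*} [Fintype α] [Fintype β]
    [FiniteDimensional ℂ V] [FiniteDimensional ℂ V₂] {B : End ℂ V₂} {C D : End ℂ V}
    {f : (α → V) →ₗ[ℂ] V₂} {g : V₂ →ₗ[ℂ] (β → V)} (hf : Function.Injective f)
    (hg : Function.Surjective g) (hfg : ∀ y, g y = 0 ↔ ∃ x, f x = y)
    (h₁ : ∀ x, B (f x) = f (diagonalEnd α C x))
    (h₂ : ∀ x, diagonalEnd β D (g x) = g (B x)) :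
    (∀ z : Unit → ℂ, simSpec (fun _ : Unit => B) z =
      Fintype.card α * simSpec (fun _ : Unit => C) z +
      Fintype.card β * simSpec (fun _ : Unit => D) z) ∧
    ∀ p q : Polynomial ℂ, Polynomial.aeval C p = 0 → Polynomial.aeval D q = 0 →
      Polynomial.aeval B ((if Fintype.card α = 0 then 1 else p) *
        (if Fintype.card β = 0 then 1 else q)) = 0 := by
  constructor
  · intro z
    rw [← simSpec_diagonalEnd (fun _ _ => Commute.refl _),
      ← simSpec_diagonalEnd (fun _ _ => Commute.refl _)]
    exact simSpec_add_of_exact (fun _ _ => Commute.refl _) hf hg hfg (fun _ => h₁)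
      (fun _ => h₂) z
  · intro p q hp hq
    exact aeval_mul_eq_zero_of_exact (fun y => (hfg y).1) h₁ h₂ 
      (aeval_diagonalEnd_ite hp) (aeval_diagonalEnd_ite hq)

end Diagonal

/-! ### Unions of spectra -/

theorem IsSpecUnion.of_mult_of_aeval {κ : Type*} [Fintype κ] {B : ι → End ℂ V₁}
    {C : κ → ι → End ℂ V₂} {p : κ → ℕ} (hB : ∀ i j, Commute (B i) (B j))
    (hC : ∀ k i j, Commute (C k i) (C k j))
    (hmult : ∀ z, simSpec B z = ∑ k, p k * simSpec (C k) z)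
    (haeval : ∀ i (P : κ → Polynomial ℂ), (∀ k, Polynomial.aeval (C k i) (P k) = 0) →
      Polynomial.aeval (B i) (∏ k, if p k = 0 then 1 else P k) = 0) :
    IsSpecUnion B C p := by
  refine ⟨hB, hC, hmult, fun S hS => ⟨?_, ?_, ?_⟩⟩
  · intro e he
    obtain ⟨k, -, hk⟩ := Multiset.mem_sum.1 he
    unfold scale at hk
    split_ifs at hk with hp
    · simp at hk
    · obtain ⟨e', he', rfl⟩ := Multiset.mem_map.1 hk
      exact Nat.mul_pos (Nat.pos_of_ne_zero hp) ((hS k).pos e' he')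
  · intro z
    classical
    have h1 : ∀ k, (((scale (p k) (S k)).filter fun e => e.1 = z).map Prod.snd).sum =
        p k * simSpec (C k) z := by
      intro k
      rw [← (hS k).mult z]
      unfold scale
      split_ifs with hp
      · simp [hp]
      · rw [Multiset.filter_map, Multiset.map_map, ← Multiset.sum_map_mul_left]
        simp only [Function.comp_def]
    rw [hmult z, ← Finset.sum_congr rfl fun k _ => h1 k]
    have h2 : ∀ T : κ → Multiset ((ι → ℂ) × ℕ),
        (((∑ k, T k).filter fun e => e.1 = z).map Prod.snd).sum =
        ∑ k, (((T k).filter fun e => e.1 = z).map Prod.snd).sum := by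
      intro T
      induction (Finset.univ : Finset κ) using Finset.cons_induction with
      | empty => simp
      | cons a s ha ih =>
        rw [Finset.sum_cons, Finset.sum_cons, Multiset.filter_add, Multiset.map_add,
          Multiset.sum_add, ih]
    convert h2 _
  · intro i
    have h1 : ∀ T : κ → Multiset ((ι → ℂ) × ℕ), ((∑ k, T k).map
        fun e => (Polynomial.X - Polynomial.C (e.1 i) : Polynomial ℂ)).prod =
        ∏ k, ((T k).map fun e => (Polynomial.X - Polynomial.C (e.1 i) : Polynomial ℂ)).prod := by
      intro T
      induction (Finset.univ : Finset κ) using Finset.cons_induction with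
      | empty => simp
      | cons a s ha ih => simp [Finset.sum_cons, Finset.prod_cons, ih]
    rw [h1]
    have h2 := haeval i (fun k => ((S k).map
        fun e => (Polynomial.X - Polynomial.C (e.1 i) : Polynomial ℂ)).prod)
      fun k => (hS k).annihil i
    convert h2 using 3 with k
    unfold scale
    split_ifs with hp
    · simp
    · simp [Multiset.map_map]

end Spectral

/-! ### Residue matrices of subsets -/

section Residue

variable {m : ℕ} {ι : Type*} {A : Fin (m + 1) → Fin (m + 1) → Matrix ι ι ℂ}

theorem residue_insert (hA : ∀ i j, A i j = A j i) {i : Fin (m + 1)} {S : Finset (Fin (m + 1))}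
    (hi : i ∉ S) : residue A (insert i S) = residue A S + ∑ j ∈ S, A i j := by
  unfold residue
  simp only [Finset.sum_filter]
  rw [Finset.sum_insert hi, Finset.sum_insert hi]
  simp only [Finset.sum_insert hi, lt_irrefl, if_false, zero_add, Finset.sum_add_distrib]
  rw [← add_assoc, add_comm, add_right_inj, ← Finset.sum_add_distrib]
  refine Finset.sum_congr rfl fun j hj => ?_
  have hne : i ≠ j := fun h => hi (h ▸ hj)
  rcases lt_or_gt_of_ne hne with h | h
  · simp [h, h.not_gt]
  · simp [h, h.not_gt, hA i j]

theorem commute_residue_of_forall [Fintype ι] {S : Finset (Fin (m + 1))} {M : Matrix ι ι ℂ}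
    (h : ∀ i ∈ S, ∀ j ∈ S, i ≠ j → Commute M (A i j)) : Commute M (residue A S) := by
  refine Commute.sum_right _ _ _ fun i hi => Commute.sum_right _ _ _ fun j hj => ?_
  obtain ⟨hj, hij⟩ := Finset.mem_filter.1 hj
  exact h i hi j hj hij.ne

end Residue

section KZResidue

variable {m N : ℕ} {A : Fin (m + 1) → Fin (m + 1) → Matrix (Fin N) (Fin N) ℂ}

theorem IsKZType.commute_residue_of_notMem (hA : IsKZType A) {i j : Fin (m + 1)} (hij : i ≠ j)
    {S : Finset (Fin (m + 1))} (hi : i ∉ S) (hj : j ∉ S) : Commute (A i j) (residue A S) :=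
  commute_residue_of_forall fun k hk l hl hkl =>
    hA.comm_disjoint i j k l hij (fun h => hi (h ▸ hk)) (fun h => hi (h ▸ hl))
      (fun h => hj (h ▸ hk)) (fun h => hj (h ▸ hl)) hkl

/-- `A i j` commutes with `A_S` if `i, j ∈ S`: apart from `A i j` itself, `A_S` is the sum of
`A_{S ∖ {i, j}}` and of the terms `A i k + A j k`. -/
theorem IsKZType.commute_residue_of_mem (hA : IsKZType A) {i j : Fin (m + 1)} (hij : i ≠ j)
    {S : Finset (Fin (m + 1))} (hi : i ∈ S) (hj : j ∈ S) : Commute (A i j) (residue A S) := by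
  set T := (S.erase i).erase j
  have hjT : j ∉ T := Finset.notMem_erase _ _
  have hiT : i ∉ T := fun h => Finset.notMem_erase i S (Finset.mem_of_mem_erase h)
  have hS : S = insert i (insert j T) := by
    rw [Finset.insert_erase (Finset.mem_erase.2 ⟨hij.symm, hj⟩), Finset.insert_erase hi]
  have hi' : i ∉ insert j T := by simp [hij, hiT]
  rw [hS, residue_insert hA.symm hi', residue_insert hA.symm hjT, Finset.sum_insert hjT]
  have h1 : Commute (A i j) (∑ k ∈ T, (A i k + A j k)) := by
    refine Commute.sum_right _ _ _ fun k hk => ?_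
    exact hA.comm_triple i j k hij (fun h => hiT (h ▸ hk)) (fun h => hjT (h ▸ hk))
  have h2 := ((hA.commute_residue_of_notMem hij hiT hjT).add_right h1).add_right
    (Commute.refl (A i j))
  rw [Finset.sum_add_distrib] at h2
  have h3 : residue A T + ∑ k ∈ T, A j k + (A i j + ∑ k ∈ T, A i k) =
      residue A T + (∑ k ∈ T, A i k + ∑ k ∈ T, A j k) + A i j := by abel
  rwa [h3]

theorem IsKZType.commute_residue_of_subset (hA : IsKZType A) {I J : Finset (Fin (m + 1))}
    (h : I ⊆ J) : Commute (residue A I) (residue A J) :=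
  (commute_residue_of_forall fun _ hi _ hj hij =>
    (hA.commute_residue_of_mem hij (h hi) (h hj)).symm).symm

theorem IsKZType.commute_residue_of_disjoint (hA : IsKZType A) {I J : Finset (Fin (m + 1))}
    (h : Disjoint I J) : Commute (residue A I) (residue A J) :=
  (commute_residue_of_forall fun _ hi _ hj hij =>
    (hA.commute_residue_of_notMem hij (Finset.disjoint_left.1 h hi)
      (Finset.disjoint_left.1 h hj)).symm).symm

end KZResidue

/-! ### The convolution in coordinates -/

section Coordinates

variable {m N : ℕ}

/-- The set `I ∖ {0}`, with `j` standing for `j.succ`. -/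
def tail (I : Finset (Fin (m + 1))) : Finset (Fin m) :=
  Finset.univ.filter fun j => j.succ ∈ I

@[simp]
theorem mem_tail {I : Finset (Fin (m + 1))} {j : Fin m} : j ∈ tail I ↔ j.succ ∈ I := by
  simp [tail]

theorem map_succEmb_tail (I : Finset (Fin (m + 1))) :
    (tail I).map (Fin.succEmb m) = I.erase 0 := by
  ext i
  induction i using Fin.cases <;> simp

theorem sum_erase_zero {M : Type*} [AddCommMonoid M] (I : Finset (Fin (m + 1)))
    (f : Fin (m + 1) → M) : ∑ i ∈ I.erase 0, f i = ∑ j ∈ tail I, f j.succ := by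
  rw [← map_succEmb_tail, Finset.sum_map]
  rfl

theorem tail_mono {I J : Finset (Fin (m + 1))} (h : I ⊆ J) : tail I ⊆ tail J := by
  intro j
  simpa using @h _

theorem disjoint_tail {I J : Finset (Fin (m + 1))} (h : Disjoint I J) :
    Disjoint (tail I) (tail J) := by
  rw [Finset.disjoint_left] at h ⊢
  intro j
  simpa using @h _

variable (A : Fin (m + 1) → Fin (m + 1) → Matrix (Fin N) (Fin N) ℂ) (μ : ℂ)

theorem conv_comm {A : Fin (m + 1) → Fin (m + 1) → Matrix (Fin N) (Fin N) ℂ}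
    (hA : ∀ i j, A i j = A j i) (i j : Fin (m + 1)) : conv A μ i j = conv A μ j i := by
  unfold conv
  congr 1
  induction i using Fin.cases with
  | zero => induction j using Fin.cases <;> rfl
  | succ a =>
    induction j using Fin.cases with
    | zero => rfl
    | succ b =>
      simp only [Fin.cases_succ]
      rcases eq_or_ne a b with rfl | hab
      · rfl
      rw [if_neg hab, if_neg hab.symm]
      ext1 r c
      simp only [convPairBlock, Matrix.of_apply, hA a.succ b.succ]
      abel

theorem curry_comp_mulVec (M : Matrix (Fin m) (Fin m) (Matrix (Fin N) (Fin N) ℂ))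
    (w : Fin m × Fin N → ℂ) (r : Fin m) :
    Function.curry (Matrix.comp (Fin m) (Fin m) (Fin N) (Fin N) ℂ M *ᵥ w) r =
      ∑ c, M r c *ᵥ Function.curry w c := by
  ext s
  simp [Matrix.mulVec, dotProduct, Fintype.sum_prod_type, Finset.sum_apply, Matrix.comp_apply]

theorem curry_conv_zero_succ (k : Fin m) (w : Fin m × Fin N → ℂ) (r : Fin m) :
    Function.curry (conv A μ 0 k.succ *ᵥ w) r =
      if r = k then ∑ c, A 0 c.succ *ᵥ Function.curry w c + μ • Function.curry w k else 0 := by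
  rw [conv, curry_comp_mulVec]
  simp only [Fin.cases_zero, Fin.cases_succ, convZeroBlock, Matrix.of_apply]
  split_ifs with h
  · simp only [Matrix.add_mulVec, Finset.sum_add_distrib]
    congr 1
    rw [Finset.sum_eq_single k]
    · simp [Matrix.smul_mulVec]
    · intro c _ hc; simp [hc]
    · simp
  · simp

theorem curry_conv_succ_succ {a b : Fin m} (hab : a ≠ b) (w : Fin m × Fin N → ℂ) (r : Fin m) :
    Function.curry (conv A μ a.succ b.succ *ᵥ w) r =
      A a.succ b.succ *ᵥ Function.curry w r +
        (if r = a then A 0 b.succ *ᵥ (Function.curry w r - Function.curry w b) else 0) +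
        (if r = b then A 0 a.succ *ᵥ (Function.curry w r - Function.curry w a) else 0) := by
  rw [conv, curry_comp_mulVec]
  simp only [Fin.cases_succ, if_neg hab, convPairBlock, Matrix.of_apply]
  simp only [Matrix.add_mulVec, Matrix.sub_mulVec, Finset.sum_add_distrib,
    Finset.sum_sub_distrib]
  have h1 : ∀ (P : Prop) [Decidable P] (c₀ : Fin m) (M : Matrix (Fin N) (Fin N) ℂ),
      ∑ c, (if P ∧ c = c₀ then M else 0) *ᵥ Function.curry w c =
        if P then M *ᵥ Function.curry w c₀ else 0 := by
    intro P _ c₀ M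
    split_ifs with hP
    · rw [Finset.sum_eq_single c₀]
      · simp [hP]
      · intro c _ hc; simp [hc]
      · simp
    · simp [hP]
  have h2 : ∑ c, (if r = c then A a.succ b.succ else 0) *ᵥ Function.curry w c =
      A a.succ b.succ *ᵥ Function.curry w r := by
    rw [Finset.sum_eq_single r]
    · simp
    · intro c _ hc; simp [hc.symm]
    · simp
  rw [h1, h1, h1, h1, h2]
  by_cases ha : r = a
  · subst ha
    simp [hab, Matrix.mulVec_sub]
    abel
  · by_cases hb : r = b
    · subst hb
      simp [ha, Matrix.mulVec_sub]
      abel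
    · simp [ha, hb]

/-- The action of `A_{I ∪ {0}} + ε_I μ`, where `ε_I = 1` if `0 ∈ I` and `ε_I = 0` otherwise. -/
def upEnd (I : Finset (Fin (m + 1))) : Module.End ℂ (Fin N → ℂ) :=
  Matrix.toLin' (residue A (insert 0 I) +
    (if 0 ∈ I then μ else 0) • (1 : Matrix (Fin N) (Fin N) ℂ))

/-- The action of `A_{I ∖ {0}}`. -/
def downEnd (I : Finset (Fin (m + 1))) : Module.End ℂ (Fin N → ℂ) :=
  Matrix.toLin' (residue A (I.erase 0))

/-- The action of `A_{0j}`, with `j` standing for `j.succ`. -/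
def zeroEnd (j : Fin m) : Module.End ℂ (Fin N → ℂ) :=
  Matrix.toLin' (A 0 j.succ)

/-- The map `w ↦ ∑_{j ∈ X} A_{0j} w_j`. -/
def sumZero (X : Finset (Fin m)) : (Fin m → Fin N → ℂ) →ₗ[ℂ] (Fin N → ℂ) :=
  ∑ j ∈ X, zeroEnd A j ∘ₗ LinearMap.proj j

/-- The part common to all rows `r ∈ I` in the action of `Ã_I`. -/
def commonRow (I : Finset (Fin (m + 1))) : (Fin m → Fin N → ℂ) →ₗ[ℂ] (Fin N → ℂ) :=
  if 0 ∈ I then sumZero A (tail I)ᶜ else -sumZero A (tail I)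

/-- The matrix `Ã_I` as an operator on tuples of vectors: in the rows `r ∈ I` it acts by
`A_{I ∪ {0}} + ε_I μ` up to a vector not depending on `r`, in the others by `A_{I ∖ {0}}`. -/
def convEnd (I : Finset (Fin (m + 1))) : Module.End ℂ (Fin m → Fin N → ℂ) :=
  LinearMap.pi fun r => if r ∈ tail I then upEnd A μ I ∘ₗ LinearMap.proj r + commonRow A I
    else downEnd A I ∘ₗ LinearMap.proj r

theorem sumZero_apply (X : Finset (Fin m)) (w : Fin m → Fin N → ℂ) :
    sumZero A X w = ∑ j ∈ X, zeroEnd A j (w j) := by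
  simp [sumZero]

theorem convEnd_of_mem {I : Finset (Fin (m + 1))} {r : Fin m} (hr : r.succ ∈ I)
    (w : Fin m → Fin N → ℂ) :
    convEnd A μ I w r = upEnd A μ I (w r) + commonRow A I w := by
  simp [convEnd, hr]

theorem convEnd_of_notMem {I : Finset (Fin (m + 1))} {r : Fin m} (hr : r.succ ∉ I)
    (w : Fin m → Fin N → ℂ) : convEnd A μ I w r = downEnd A I (w r) := by
  simp [convEnd, hr]

variable {A}

theorem residue_insert_zero {ι : Type*} {A : Fin (m + 1) → Fin (m + 1) → Matrix ι ι ℂ}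
    (hA : ∀ i j, A i j = A j i) (I : Finset (Fin (m + 1))) :
    residue A (insert 0 I) = residue A (I.erase 0) + ∑ j ∈ tail I, A 0 j.succ := by
  have : insert 0 I = insert 0 (I.erase 0) := by
    ext i; by_cases h : i = 0 <;> simp [h]
  rw [this, residue_insert hA (Finset.notMem_erase _ _), sum_erase_zero]

theorem upEnd_eq (hA : ∀ i j, A i j = A j i) (I : Finset (Fin (m + 1))) (v : Fin N → ℂ) :
    upEnd A μ I v = downEnd A I v + ∑ j ∈ tail I, zeroEnd A j v +
      (if 0 ∈ I then μ else 0) • v := by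
  simp only [upEnd, downEnd, zeroEnd, residue_insert_zero hA, map_add, map_sum, map_smul,
    LinearMap.add_apply, LinearMap.sum_apply, LinearMap.smul_apply, Matrix.toLin'_one,
    LinearMap.id_apply]

theorem curry_residue_conv_map (hA : ∀ i j, A i j = A j i) (T : Finset (Fin m))
    (w : Fin m × Fin N → ℂ) (r : Fin m) :
    Function.curry (residue (conv A μ) (T.map (Fin.succEmb m)) *ᵥ w) r =
      residue A (T.map (Fin.succEmb m)) *ᵥ Function.curry w r +
        if r ∈ T then ∑ j ∈ T, A 0 j.succ *ᵥ (Function.curry w r - Function.curry w j)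
        else 0 := by
  induction T using Finset.induction_on with
  | empty => ext s; simp [residue]
  | insert i T hi ih =>
    have hi' : Fin.succEmb m i ∉ T.map (Fin.succEmb m) := by simpa using hi
    rw [Finset.map_insert, residue_insert (conv_comm μ hA) hi', residue_insert hA hi',
      Finset.sum_map, Finset.sum_map, Matrix.add_mulVec, Matrix.add_mulVec]
    have hadd : ∀ u v : Fin m × Fin N → ℂ,
        Function.curry (u + v) r = Function.curry u r + Function.curry v r := fun _ _ => rfl
    have hsum : Function.curry ((∑ j ∈ T, conv A μ (Fin.succEmb m i) (Fin.succEmb m j)) *ᵥ w) r =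
        ∑ j ∈ T, Function.curry (conv A μ i.succ j.succ *ᵥ w) r := by
      rw [Matrix.sum_mulVec]
      ext s
      simp [Function.curry, Finset.sum_apply]
    rw [hadd, ih, hsum, Finset.sum_congr rfl fun j hj =>
      curry_conv_succ_succ A μ (a := i) (b := j) (fun h => hi (h ▸ hj)) w r]
    rw [Finset.sum_add_distrib, Finset.sum_add_distrib, Matrix.sum_mulVec]
    rcases eq_or_ne r i with rfl | hri
    · have h0 : ∑ j ∈ T, (if r = j then
          A 0 r.succ *ᵥ (Function.curry w r - Function.curry w r) else 0) = 0 :=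
        Finset.sum_eq_zero fun j _ => by simp
      rw [h0]
      simp [hi, Finset.sum_insert hi, add_assoc]
    · by_cases hrT : r ∈ T
      · simp [hri, hrT, Finset.sum_insert hi]
        abel
      · simp [hri, hrT]

theorem curry_residue_conv (hA : ∀ i j, A i j = A j i) (I : Finset (Fin (m + 1)))
    (w : Fin m × Fin N → ℂ) :
    Function.curry (Matrix.toLin' (residue (conv A μ) I) w) =
      convEnd A μ I (Function.curry w) := by
  funext r
  rw [Matrix.toLin'_apply]
  have h1 := curry_residue_conv_map μ hA (tail I) w r
  rw [map_succEmb_tail] at h1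
  have hd : ∀ v, downEnd A I v = residue A (I.erase 0) *ᵥ v := fun v => rfl
  by_cases h0 : 0 ∈ I
  · have h2 : residue (conv A μ) I =
        residue (conv A μ) (I.erase 0) + ∑ j ∈ tail I, conv A μ 0 j.succ := by
      rw [← residue_insert_zero (conv_comm μ hA), Finset.insert_eq_of_mem h0]
    have hadd : ∀ u v : Fin m × Fin N → ℂ,
        Function.curry (u + v) r = Function.curry u r + Function.curry v r := fun _ _ => rfl
    have hsum : Function.curry ((∑ j ∈ tail I, conv A μ 0 j.succ) *ᵥ w) r =
        ∑ j ∈ tail I, Function.curry (conv A μ 0 j.succ *ᵥ w) r := by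
      rw [Matrix.sum_mulVec]
      ext s
      simp [Function.curry, Finset.sum_apply]
    rw [h2, Matrix.add_mulVec, hadd, h1, hsum,
      Finset.sum_congr rfl fun j _ => curry_conv_zero_succ A μ j w r]
    by_cases hr : r.succ ∈ I
    · rw [convEnd_of_mem A μ hr, upEnd_eq μ hA, commonRow, if_pos h0, if_pos h0,
        if_pos (mem_tail.2 hr), hd, sumZero_apply, Finset.sum_ite_eq,
        if_pos (mem_tail.2 hr)]
      have h3 := Finset.sum_add_sum_compl (tail I)
        (fun j => A 0 j.succ *ᵥ Function.curry w j)
      rw [← h3]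
      simp only [zeroEnd, Matrix.toLin'_apply, Matrix.mulVec_sub, Finset.sum_sub_distrib]
      abel
    · rw [convEnd_of_notMem A μ hr, hd]
      simp [hr]
  · rw [Finset.erase_eq_of_notMem h0] at h1 hd
    rw [h1]
    by_cases hr : r.succ ∈ I
    · rw [convEnd_of_mem A μ hr, upEnd_eq μ hA, commonRow, if_neg h0, if_neg h0,
        if_pos (mem_tail.2 hr), hd, LinearMap.neg_apply, sumZero_apply]
      simp only [zeroEnd, Matrix.toLin'_apply, Matrix.mulVec_sub, Finset.sum_sub_distrib]
      rw [zero_smul]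
      abel
    · rw [convEnd_of_notMem A μ hr, hd]
      simp [hr]

/-! ### Commutation of the generalized residue matrices -/

theorem IsKZType.commute_zeroEnd_upEnd (hA : IsKZType A) {I : Finset (Fin (m + 1))} {j : Fin m}
    (hj : j.succ ∈ I) : Commute (zeroEnd A j) (upEnd A μ I) := by
  have h : Commute (A 0 j.succ) (residue A (insert 0 I) +
      (if 0 ∈ I then μ else 0) • (1 : Matrix (Fin N) (Fin N) ℂ)) :=
    (hA.commute_residue_of_mem (Fin.succ_ne_zero j).symm (Finset.mem_insert_self _ _)
      (Finset.mem_insert_of_mem hj)).add_right ((Commute.one_right _).smul_right _)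
  exact h.map (Matrix.toLinAlgEquiv' (R := ℂ) (n := Fin N))

theorem IsKZType.commute_zeroEnd_downEnd (hA : IsKZType A) {I : Finset (Fin (m + 1))}
    {j : Fin m} (hj : j.succ ∉ I) : Commute (zeroEnd A j) (downEnd A I) :=
  (hA.commute_residue_of_notMem (Fin.succ_ne_zero j).symm (Finset.notMem_erase _ _)
    (fun h => hj (Finset.mem_of_mem_erase h))).map (Matrix.toLinAlgEquiv' (R := ℂ) (n := Fin N))

theorem IsKZType.commute_upEnd (hA : IsKZType A) {I J : Finset (Fin (m + 1))} (h : I ⊆ J) :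
    Commute (upEnd A μ I) (upEnd A μ J) := by
  have h' : Commute (residue A (insert 0 I) +
        (if 0 ∈ I then μ else 0) • (1 : Matrix (Fin N) (Fin N) ℂ))
      (residue A (insert 0 J) + (if 0 ∈ J then μ else 0) • (1 : Matrix (Fin N) (Fin N) ℂ)) :=
    ((hA.commute_residue_of_subset (Finset.insert_subset_insert 0 h)).add_right
      ((Commute.one_right _).smul_right _)).add_left ((Commute.one_left _).smul_left _)
  exact h'.map (Matrix.toLinAlgEquiv' (R := ℂ) (n := Fin N))

theorem IsKZType.commute_downEnd_upEnd (hA : IsKZType A) {I J : Finset (Fin (m + 1))}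
    (h : Disjoint I J ∨ I ⊆ J) : Commute (downEnd A I) (upEnd A μ J) := by
  have h' : Commute (residue A (I.erase 0))
      (residue A (insert 0 J) + (if 0 ∈ J then μ else 0) • (1 : Matrix (Fin N) (Fin N) ℂ)) := by
    refine Commute.add_right ?_ ((Commute.one_right _).smul_right _)
    rcases h with h | h
    · refine hA.commute_residue_of_disjoint ?_
      rw [Finset.disjoint_insert_right]
      exact ⟨Finset.notMem_erase _ _, h.mono_left (Finset.erase_subset _ _)⟩
    · exact hA.commute_residue_of_subset
        (((Finset.erase_subset _ _).trans h).trans (Finset.subset_insert _ _))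
  exact h'.map (Matrix.toLinAlgEquiv' (R := ℂ) (n := Fin N))

theorem IsKZType.commute_downEnd (hA : IsKZType A) {I J : Finset (Fin (m + 1))}
    (h : Disjoint I J ∨ I ⊆ J) : Commute (downEnd A I) (downEnd A J) := by
  have h' : Commute (residue A (I.erase 0)) (residue A (J.erase 0)) := by
    rcases h with h | h
    · exact hA.commute_residue_of_disjoint
        (h.mono (Finset.erase_subset _ _) (Finset.erase_subset _ _))
    · exact hA.commute_residue_of_subset (Finset.erase_subset_erase _ h)
  exact h'.map (Matrix.toLinAlgEquiv' (R := ℂ) (n := Fin N))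

/-- The sums `∑_{j ∈ X} A_{0j} w_j` intertwine `Ã_I` with `A_{I ∖ {0}}`. -/
theorem IsKZType.sumZero_convEnd (hA : IsKZType A) {I : Finset (Fin (m + 1))}
    {X : Finset (Fin m)} (h : Disjoint (tail I) X ∨ (0 ∉ I ∧ tail I ⊆ X))
    (w : Fin m → Fin N → ℂ) :
    sumZero A X (convEnd A μ I w) = downEnd A I (sumZero A X w) := by
  have key : ∀ Y : Finset (Fin m), Disjoint (tail I) Y →
      sumZero A Y (convEnd A μ I w) = downEnd A I (sumZero A Y w) := by
    intro Y hY
    rw [sumZero_apply, sumZero_apply, map_sum]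
    refine Finset.sum_congr rfl fun j hj => ?_
    have hjI : j.succ ∉ I := fun h => Finset.disjoint_left.1 hY (mem_tail.2 h) hj
    rw [convEnd_of_notMem A μ hjI]
    exact LinearMap.congr_fun (hA.commute_zeroEnd_downEnd hjI).eq _
  rcases h with h | ⟨h0, h⟩
  · exact key X h
  · have hsplit : ∀ u, sumZero A X u = sumZero A (X \ tail I) u + sumZero A (tail I) u := by
      intro u
      simp only [sumZero_apply]
      exact (Finset.sum_sdiff h).symm
    rw [hsplit, hsplit, key _ Finset.disjoint_sdiff, map_add, add_right_inj]
    have h1 : sumZero A (tail I) (convEnd A μ I w) =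
        upEnd A μ I (sumZero A (tail I) w) +
          ∑ j ∈ tail I, zeroEnd A j (commonRow A I w) := by
      rw [sumZero_apply, sumZero_apply, map_sum, ← Finset.sum_add_distrib]
      refine Finset.sum_congr rfl fun j hj => ?_
      rw [convEnd_of_mem A μ (mem_tail.1 hj), map_add]
      congr 1
      exact LinearMap.congr_fun (hA.commute_zeroEnd_upEnd μ (mem_tail.1 hj)).eq _
    rw [h1, upEnd_eq μ hA.symm, commonRow, if_neg h0, if_neg h0]
    simp

theorem IsKZType.commonRow_convEnd (hA : IsKZType A) {I J : Finset (Fin (m + 1))}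
    (h : Disjoint I J ∨ I ⊆ J) (w : Fin m → Fin N → ℂ) :
    commonRow A J (convEnd A μ I w) = downEnd A I (commonRow A J w) := by
  unfold commonRow
  split_ifs with h0
  · refine hA.sumZero_convEnd μ ?_ w
    rcases h with h | h
    · refine Or.inr ⟨fun h0' => Finset.disjoint_left.1 h h0' h0, ?_⟩
      exact le_compl_iff_disjoint_right.2 (disjoint_tail h)
    · exact Or.inl (disjoint_compl_right.mono_left (tail_mono h))
  · rw [LinearMap.neg_apply, LinearMap.neg_apply, map_neg, hA.sumZero_convEnd μ ?_ w]
    rcases h with h | h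
    · exact Or.inl (disjoint_tail h)
    · exact Or.inr ⟨fun h0' => h0 (h h0'), tail_mono h⟩

theorem IsKZType.commonRow_convEnd_of_subset (hA : IsKZType A) {I J : Finset (Fin (m + 1))}
    (h : I ⊆ J) (w : Fin m → Fin N → ℂ) :
    commonRow A I (convEnd A μ J w) = upEnd A μ J (commonRow A I w) +
      downEnd A I (commonRow A J w) - upEnd A μ I (commonRow A J w) := by
  have hin : ∀ Y ⊆ tail J, sumZero A Y (convEnd A μ J w) = upEnd A μ J (sumZero A Y w) +
      ∑ j ∈ Y, zeroEnd A j (commonRow A J w) := by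
    intro Y hY
    rw [sumZero_apply, sumZero_apply, map_sum, ← Finset.sum_add_distrib]
    refine Finset.sum_congr rfl fun j hj => ?_
    have hjJ := mem_tail.1 (hY hj)
    rw [convEnd_of_mem A μ hjJ, map_add]
    congr 1
    exact LinearMap.congr_fun (hA.commute_zeroEnd_upEnd μ hjJ).eq _
  rw [upEnd_eq μ hA.symm I]
  by_cases h0 : 0 ∈ I
  · have h0J := h h0
    have hsplit : ∀ u, sumZero A (tail I)ᶜ u =
        sumZero A (tail J \ tail I) u + sumZero A (tail J)ᶜ u := by
      intro u
      simp only [sumZero_apply]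
      rw [← Finset.sum_union]
      · congr 1
        ext j
        have := @tail_mono _ _ _ h j
        simp only [Finset.mem_compl, Finset.mem_union, Finset.mem_sdiff]
        tauto
      · exact Finset.disjoint_left.2 fun j hj hj' =>
          Finset.mem_compl.1 hj' (Finset.mem_sdiff.1 hj).1
    have hJ : commonRow A J = sumZero A (tail J)ᶜ := if_pos h0J
    have hI : commonRow A I = sumZero A (tail I)ᶜ := if_pos h0
    have hs := Finset.sum_sdiff (tail_mono h) (f := fun j => zeroEnd A j (commonRow A J w))
    rw [hI, hsplit, hsplit, hin _ Finset.sdiff_subset,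
      hA.sumZero_convEnd μ (Or.inl disjoint_compl_right), map_add, ← hJ,
      upEnd_eq μ hA.symm J (commonRow A J w), ← hs, if_pos h0, if_pos h0J]
    abel
  · have hI : commonRow A I = -sumZero A (tail I) := if_neg h0
    rw [hI, LinearMap.neg_apply, LinearMap.neg_apply, hin _ (tail_mono h), if_neg h0, map_neg]
    simp only [zero_smul]
    abel

theorem IsKZType.commute_convEnd_of_le (hA : IsKZType A) {I J : Finset (Fin (m + 1))}
    (h : I ⊆ J) : Commute (convEnd A μ I) (convEnd A μ J) := by
  refine LinearMap.ext fun w => funext fun r => ?_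
  simp only [Module.End.mul_apply]
  have c1 := fun v => LinearMap.congr_fun (hA.commute_upEnd μ h).eq v
  have c2 := fun v => LinearMap.congr_fun (hA.commute_downEnd_upEnd μ (Or.inr h)).eq v
  have c3 := fun v => LinearMap.congr_fun (hA.commute_downEnd (Or.inr h)).eq v
  simp only [Module.End.mul_apply] at c1 c2 c3
  by_cases hrJ : r.succ ∈ J
  · by_cases hrI : r.succ ∈ I
    · rw [convEnd_of_mem A μ hrI, convEnd_of_mem A μ hrJ, convEnd_of_mem A μ hrJ,
        convEnd_of_mem A μ hrI, hA.commonRow_convEnd μ (Or.inr h),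
        hA.commonRow_convEnd_of_subset μ h, map_add, map_add, c1]
      abel
    · rw [convEnd_of_notMem A μ hrI, convEnd_of_mem A μ hrJ, convEnd_of_mem A μ hrJ,
        convEnd_of_notMem A μ hrI, hA.commonRow_convEnd μ (Or.inr h), map_add, c2]
  · have hrI : r.succ ∉ I := fun hr => hrJ (h hr)
    rw [convEnd_of_notMem A μ hrI, convEnd_of_notMem A μ hrJ, convEnd_of_notMem A μ hrJ,
      convEnd_of_notMem A μ hrI, c3]

theorem IsKZType.commute_convEnd_of_disjoint (hA : IsKZType A) {I J : Finset (Fin (m + 1))}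
    (h : Disjoint I J) : Commute (convEnd A μ I) (convEnd A μ J) := by
  refine LinearMap.ext fun w => funext fun r => ?_
  simp only [Module.End.mul_apply]
  have c1 := fun v =>
    LinearMap.congr_fun (hA.commute_downEnd_upEnd μ (Or.inl h.symm)).eq v
  have c2 := fun v => LinearMap.congr_fun (hA.commute_downEnd_upEnd μ (Or.inl h)).eq v
  have c3 := fun v => LinearMap.congr_fun (hA.commute_downEnd (Or.inl h)).eq v
  simp only [Module.End.mul_apply] at c1 c2 c3
  by_cases hrI : r.succ ∈ I
  · have hrJ : r.succ ∉ J := Finset.disjoint_left.1 h hrI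
    rw [convEnd_of_mem A μ hrI, convEnd_of_notMem A μ hrJ, convEnd_of_notMem A μ hrJ,
      convEnd_of_mem A μ hrI, hA.commonRow_convEnd μ (Or.inl h.symm), map_add, c1]
  · by_cases hrJ : r.succ ∈ J
    · rw [convEnd_of_notMem A μ hrI, convEnd_of_mem A μ hrJ, convEnd_of_mem A μ hrJ,
        convEnd_of_notMem A μ hrI, hA.commonRow_convEnd μ (Or.inl h), map_add, c2]
    · rw [convEnd_of_notMem A μ hrI, convEnd_of_notMem A μ hrJ, convEnd_of_notMem A μ hrJ,
        convEnd_of_notMem A μ hrI, c3]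

end Coordinates

/-! ### Maximal commuting families -/

section Families

variable {α : Type*} [DecidableEq α] {F : Finset (Finset α)}

theorem IsCommutingFamily.compat (hF : IsCommutingFamily F) {I J : Finset α} (hI : I ∈ F)
    (hJ : J ∈ F) : Disjoint I J ∨ I ⊆ J ∨ J ⊆ I := by
  by_cases h : I = J
  · exact Or.inr (Or.inl h.subset)
  · rcases hF.2 I hI J hJ h with h | h | h
    · exact Or.inl h
    · exact Or.inr (Or.inl h.subset)
    · exact Or.inr (Or.inr h.subset)

theorem compat_singleton (j : α) (J : Finset α) :
    Disjoint {j} J ∨ {j} ⊆ J ∨ J ⊆ {j} := by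
  by_cases h : j ∈ J
  · exact Or.inr (Or.inl (by simpa using h))
  · exact Or.inl (by simpa using h)

theorem IsCommutingFamily.compat_node (hF : IsCommutingFamily F) {I J : Finset α}
    (hI : IsNode F I) (hJ : IsNode F J) : Disjoint I J ∨ I ⊆ J ∨ J ⊆ I := by
  rcases hI with hI | ⟨i, rfl⟩
  · rcases hJ with hJ | ⟨j, rfl⟩
    · exact hF.compat hI hJ
    · rcases compat_singleton j I with h | h | h
      exacts [Or.inl h.symm, Or.inr (Or.inr h), Or.inr (Or.inl h)]
  · exact compat_singleton i J

theorem IsCommutingFamily.node_nonempty (hF : IsCommutingFamily F) {I : Finset α}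
    (hI : IsNode F I) : I.Nonempty := by
  rcases hI with hI | ⟨i, rfl⟩
  · exact Finset.card_pos.1 ((Nat.zero_lt_one).trans (hF.1 I hI))
  · exact Finset.singleton_nonempty i

theorem IsNode.mem_of_card {I : Finset α} (hI : IsNode F I) (h : 1 < I.card) : I ∈ F := by
  rcases hI with hI | ⟨i, rfl⟩
  · exact hI
  · simp at h

theorem IsMaxCommutingFamily.mem_of_compat (hF : IsMaxCommutingFamily F) {I : Finset α}
    (hI : 1 < I.card) (h : ∀ J ∈ F, Disjoint I J ∨ I ⊆ J ∨ J ⊆ I) : I ∈ F := by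
  have hc : IsCommutingFamily (insert I F) := by
    have h' : ∀ J ∈ F, I ≠ J → Disjoint I J ∨ I ⊂ J ∨ J ⊂ I := by
      intro J hJ hne
      rcases h J hJ with h | h | h
      · exact Or.inl h
      · exact Or.inr (Or.inl (lt_of_le_of_ne h hne))
      · exact Or.inr (Or.inr (lt_of_le_of_ne h hne.symm))
    refine ⟨fun J hJ => ?_, fun J hJ K hK hne => ?_⟩
    · rcases Finset.mem_insert.1 hJ with rfl | hJ
      · exact hI
      · exact hF.prop.1 J hJ
    · rcases Finset.mem_insert.1 hJ with hJI | hJF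
      · rcases Finset.mem_insert.1 hK with hKI | hKF
        · exact absurd (hJI.trans hKI.symm) hne
        · exact hJI ▸ h' K hKF (hJI ▸ hne)
      · rcases Finset.mem_insert.1 hK with hKI | hKF
        · rcases h' J hJF (hKI ▸ hne.symm) with h | h | h
          exacts [Or.inl (hKI ▸ h.symm), Or.inr (Or.inr (hKI ▸ h)), Or.inr (Or.inl (hKI ▸ h))]
        · exact hF.prop.2 J hJF K hKF hne
  exact hF.le_of_ge hc (Finset.subset_insert I F) (Finset.mem_insert_self I F)

theorem IsMaxCommutingFamily.univ_mem [Fintype α] (hF : IsMaxCommutingFamily F)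
    (h : 1 < Fintype.card α) : Finset.univ ∈ F :=
  hF.mem_of_compat h fun J _ => Or.inr (Or.inr (Finset.subset_univ J))

/-- Every game of a maximal family has two sides. One of them may be taken to be a largest node
`X` properly contained in the game `I`: the complement `I ∖ X` is compatible with all members. -/
theorem IsMaxCommutingFamily.exists_split (hF : IsMaxCommutingFamily F) {I : Finset α}
    (hI : I ∈ F) : ∃ X ⊆ I, IsNode F X ∧ IsNode F (I \ X) := by
  classical
  have hcard := hF.prop.1 I hI
  set T := I.powerset.filter fun X => IsNode F X ∧ X ≠ I
  have hT : T.Nonempty := by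
    obtain ⟨x, hx⟩ := Finset.card_pos.1 ((Nat.zero_lt_one).trans hcard)
    refine ⟨{x}, Finset.mem_filter.2 ⟨by simpa using hx, Or.inr ⟨x, rfl⟩, ?_⟩⟩
    rintro rfl
    simp at hcard
  obtain ⟨X, hXT, hmax⟩ := Finset.exists_max_image T Finset.card hT
  obtain ⟨hXI, hX, hne⟩ := Finset.mem_filter.1 hXT
  rw [Finset.mem_powerset] at hXI
  refine ⟨X, hXI, hX, ?_⟩
  have hpos : 0 < (I \ X).card := by
    rw [Finset.card_pos, Finset.sdiff_nonempty]
    exact fun h => hne (hXI.antisymm h)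
  rcases (Nat.succ_le_of_lt hpos).eq_or_lt with h1 | h1
  · exact Or.inr (Finset.card_eq_one.1 h1.symm)
  · refine Or.inl (hF.mem_of_compat h1 fun J hJ => ?_)
    rcases hF.prop.compat hI hJ with h | h | h
    · exact Or.inl (h.mono_left Finset.sdiff_subset)
    · exact Or.inr (Or.inl (Finset.sdiff_subset.trans h))
    · by_cases hJI : J = I
      · exact Or.inr (Or.inl (hJI ▸ Finset.sdiff_subset))
      rcases hF.prop.compat_node hX (Or.inl hJ) with h' | h' | h'
      · refine Or.inr (Or.inr fun x hx => Finset.mem_sdiff.2 ⟨h hx, ?_⟩)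
        exact Finset.disjoint_right.1 h' hx
      · have hle := hmax J (Finset.mem_filter.2 ⟨Finset.mem_powerset.2 h, Or.inl hJ, hJI⟩)
        rw [Finset.eq_of_subset_of_card_le h' hle]
        exact Or.inl Finset.sdiff_disjoint
      · exact Or.inl (Finset.sdiff_disjoint.mono_right h')

/-- A node properly contained in a game lies in one of the two sides. -/
theorem IsCommutingFamily.subset_side (hF : IsCommutingFamily F) {I K X : Finset α}
    (hI : IsNode F I) (hXK : X ⊆ K) (hX : IsNode F X) (hX' : IsNode F (K \ X)) (hIK : I ⊂ K) :
    I ⊆ X ∨ I ⊆ K \ X := by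
  have hd : Disjoint I X → I ⊆ K \ X := fun h x hx =>
    Finset.mem_sdiff.2 ⟨hIK.subset hx, Finset.disjoint_left.1 h hx⟩
  have hd' : Disjoint I (K \ X) → I ⊆ X := fun h x hx => by
    by_contra hxX
    exact Finset.disjoint_left.1 h hx (Finset.mem_sdiff.2 ⟨hIK.subset hx, hxX⟩)
  rcases hF.compat_node hI hX with h | h | h
  · exact Or.inr (hd h)
  · exact Or.inl h
  rcases hF.compat_node hI hX' with h' | h' | h'
  · exact Or.inl (hd' h')
  · exact Or.inr h'
  · refine absurd ?_ hIK.2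
    rw [← Finset.union_sdiff_of_subset hXK]
    exact Finset.union_subset h h'

/-- A commuting family that contains the whole set and in which every member has two sides is
maximal: the least member containing a new set would have both of its sides inside the new set. -/
theorem IsCommutingFamily.isMax_of_split [Fintype α] (hF : IsCommutingFamily F)
    (huniv : Finset.univ ∈ F)
    (hsplit : ∀ I ∈ F, ∃ X ⊆ I, IsNode F X ∧ IsNode F (I \ X)) : IsMaxCommutingFamily F := by
  refine ⟨hF, fun G hG hFG J hJ => ?_⟩
  have hT : (F.filter fun I => J ⊆ I).Nonempty :=
    ⟨Finset.univ, Finset.mem_filter.2 ⟨huniv, Finset.subset_univ J⟩⟩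
  obtain ⟨I, hIT, hmin⟩ := Finset.exists_min_image _ Finset.card hT
  obtain ⟨hI, hJI⟩ := Finset.mem_filter.1 hIT
  obtain ⟨X, hXI, hX, hX'⟩ := hsplit I hI
  have hnode : ∀ {Y}, IsNode F Y → IsNode G Y := fun h => h.imp (fun h => hFG h) id
  -- a node properly contained in `I` cannot contain `J`
  have hnot : ∀ Y, IsNode F Y → Y ⊂ I → ¬ J ⊆ Y := by
    intro Y hY hYI hJY
    have hYF : Y ∈ F := hY.mem_of_card ((hG.1 J hJ).trans_le (Finset.card_le_card hJY))
    exact absurd (hmin Y (Finset.mem_filter.2 ⟨hYF, hJY⟩))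
      (not_le.2 (Finset.card_lt_card hYI))
  have hXne := hF.node_nonempty hX
  have hXne' := hF.node_nonempty hX'
  have hXI' : X ⊂ I := by
    refine lt_of_le_of_ne hXI fun h => ?_
    rw [h, Finset.sdiff_self] at hXne'
    exact Finset.not_nonempty_empty hXne'
  have hXI'' : I \ X ⊂ I := Finset.sdiff_ssubset hXI hXne
  by_cases hJI' : J = I
  · exact hJI' ▸ hI
  rcases hG.subset_side (Or.inl hJ) hXI (hnode hX) (hnode hX') (lt_of_le_of_ne hJI hJI')
    with h | h
  · exact absurd h (hnot X hX hXI')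
  · exact absurd h (hnot _ hX' hXI'')

end Families

/-! ### Deleting and inserting a team -/

section Teams

variable {α : Type*} [DecidableEq α] {F : Finset (Finset α)} {i : α} {J : Finset α}

theorem md_of_subset {I : Finset α} (h : J ⊆ I) : md i J I = insert i I := if_pos h

theorem md_of_not_subset {I : Finset α} (h : ¬ J ⊆ I) : md i J I = I.erase i := if_neg h

theorem md_compat {I K : Finset α} (hJ : J.Nonempty)
    (h : Disjoint I K ∨ I ⊆ K ∨ K ⊆ I) :
    Disjoint (md i J I) (md i J K) ∨ md i J I ⊆ md i J K ∨ md i J K ⊆ md i J I := by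
  have hmono : ∀ {I K : Finset α}, I ⊆ K → md i J I ⊆ md i J K := by
    intro I K h
    unfold md
    split_ifs with h1 h2
    · exact Finset.insert_subset_insert i h
    · exact absurd (h1.trans h) h2
    · exact ((Finset.erase_subset i I).trans h).trans (Finset.subset_insert i K)
    · exact Finset.erase_subset_erase i h
  have hdis : ∀ {I K : Finset α}, Disjoint I K → J ⊆ I →
      Disjoint (md i J I) (md i J K) := by
    intro I K h hJI
    have hJK : ¬ J ⊆ K := by
      obtain ⟨x, hx⟩ := hJ
      exact fun hJK => Finset.disjoint_left.1 h (hJI hx) (hJK hx)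
    rw [md_of_subset hJI, md_of_not_subset hJK, Finset.disjoint_insert_left]
    exact ⟨Finset.notMem_erase i K, h.mono_right (Finset.erase_subset i K)⟩
  rcases h with h | h | h
  · left
    by_cases hI : J ⊆ I
    · exact hdis h hI
    · by_cases hK : J ⊆ K
      · exact (hdis h.symm hK).symm
      · rw [md_of_not_subset hI, md_of_not_subset hK]
        exact h.mono (Finset.erase_subset i I) (Finset.erase_subset i K)
  · exact Or.inr (Or.inl (hmono h))
  · exact Or.inr (Or.inr (hmono h))

theorem md_compat_insert_of_compat {I : Finset α} (h : Disjoint I J ∨ I ⊆ J ∨ J ⊆ I) :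
    Disjoint (md i J I) (insert i J) ∨ md i J I ⊆ insert i J ∨ insert i J ⊆ md i J I := by
  by_cases hJI : J ⊆ I
  · rw [md_of_subset hJI]
    exact Or.inr (Or.inr (Finset.insert_subset_insert i hJI))
  · rw [md_of_not_subset hJI]
    rcases h with h | h | h
    · left
      rw [Finset.disjoint_insert_right]
      exact ⟨Finset.notMem_erase i I, h.mono_left (Finset.erase_subset i I)⟩
    · exact Or.inr (Or.inl (((Finset.erase_subset i I).trans h).trans
        (Finset.subset_insert i J)))
    · exact absurd h hJI

theorem md_compat_erase_of_compat {I : Finset α} (h : Disjoint I J ∨ I ⊆ J ∨ J ⊆ I) :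
    Disjoint (md i J I) (J.erase i) ∨ md i J I ⊆ J.erase i ∨ J.erase i ⊆ md i J I := by
  by_cases hJI : J ⊆ I
  · rw [md_of_subset hJI]
    exact Or.inr (Or.inr (((Finset.erase_subset i J).trans hJI).trans
      (Finset.subset_insert i I)))
  · rw [md_of_not_subset hJI]
    rcases h with h | h | h
    · exact Or.inl (h.mono (Finset.erase_subset i I) (Finset.erase_subset i J))
    · exact Or.inr (Or.inl (Finset.erase_subset_erase i h))
    · exact absurd h hJI

/-- The family obtained from `F` by moving team `i` to the node `J`, described by its members; see
`IsCommutingFamily.insertTeam_deleteTeam` for the description in two steps. -/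
def moveTeam (i : α) (J : Finset α) (F : Finset (Finset α)) : Finset (Finset α) :=
  (F.image (md i J) ∪ {insert i J, J.erase i}).filter fun I => 1 < I.card

theorem mem_moveTeam {X : Finset α} : X ∈ moveTeam i J F ↔
    ((∃ I ∈ F, md i J I = X) ∨ X = insert i J ∨ X = J.erase i) ∧ 1 < X.card := by
  simp only [moveTeam, Finset.mem_filter, Finset.mem_union, Finset.mem_image, Finset.mem_insert,
    Finset.mem_singleton]

theorem insert_eq_of_erase_eq {I K : Finset α} (h : I.erase i = K.erase i) :
    insert i I = insert i K := by
  ext x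
  have := Finset.ext_iff.1 h x
  by_cases hx : x = i
  · simp [hx]
  · simpa [hx] using this

theorem insert_erase_eq (I : Finset α) : insert i (I.erase i) = insert i I :=
  insert_eq_of_erase_eq (by simp)

/-- If `J` without team `i` is properly contained in `I`, then so is `J`. -/
theorem IsCommutingFamily.subset_of_erase_ssubset (hF : IsCommutingFamily F) (hJ : IsNode F J)
    (hJi : (J.erase i).Nonempty) {I : Finset α} (hI : IsNode F I)
    (h : J.erase i ⊂ I.erase i) : J ⊆ I := by
  rcases hF.compat_node hJ hI with h' | h' | h'
  · obtain ⟨x, hx⟩ := hJi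
    exact absurd (Finset.mem_of_mem_erase (h.subset hx))
      (Finset.disjoint_left.1 h' (Finset.mem_of_mem_erase hx))
  · exact h'
  · exact absurd (Finset.erase_subset_erase i h') h.2

theorem IsCommutingFamily.insertTeam_deleteTeam (hF : IsCommutingFamily F) (hJ : IsNode F J)
    (hJi : (J.erase i).Nonempty) :
    insertTeam i (J.erase i) (deleteTeam i F) = moveTeam i J F := by
  have hcard : 1 < (insert i (J.erase i)).card := by
    rw [Finset.card_insert_of_notMem (Finset.notMem_erase i J)]
    exact Nat.succ_lt_succ (Finset.card_pos.2 hJi)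
  ext X
  rw [mem_moveTeam]
  simp only [insertTeam, deleteTeam, Finset.mem_union, Finset.mem_filter, Finset.mem_image,
    Finset.mem_singleton]
  constructor
  · rintro ((⟨⟨⟨I, hI, rfl⟩, hc⟩, hn⟩ | ⟨_, ⟨⟨⟨I, hI, rfl⟩, hc⟩, hs⟩, rfl⟩) | rfl)
    · refine ⟨?_, hc⟩
      by_cases hJI : J ⊆ I
      · refine Or.inr (Or.inr ?_)
        by_contra hne
        exact hn (lt_of_le_of_ne (Finset.erase_subset_erase i hJI) fun h => hne h.symm)
      · exact Or.inl ⟨I, hI, md_of_not_subset hJI⟩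
    · rw [insert_erase_eq]
      refine ⟨Or.inl ⟨I, hI, ?_⟩, ?_⟩
      · rw [md_of_subset (hF.subset_of_erase_ssubset hJ hJi (Or.inl hI) hs)]
      · exact (hF.1 I hI).trans_le (Finset.card_le_card (Finset.subset_insert i I))
    · exact ⟨Or.inr (Or.inl (insert_erase_eq J)), hcard⟩
  · rintro ⟨⟨I, hI, rfl⟩ | rfl | rfl, hc⟩
    · by_cases hJI : J ⊆ I
      · rw [md_of_subset hJI] at hc ⊢
        by_cases he : J.erase i = I.erase i
        · exact Or.inr (by rw [he, insert_erase_eq])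
        · have hs : J.erase i ⊂ I.erase i :=
            lt_of_le_of_ne (Finset.erase_subset_erase i hJI) he
          refine Or.inl (Or.inr ⟨I.erase i, ⟨⟨⟨I, hI, rfl⟩, ?_⟩, hs⟩, insert_erase_eq I⟩)
          exact (Nat.succ_le_of_lt (Finset.card_pos.2 hJi)).trans_lt (Finset.card_lt_card hs)
      · rw [md_of_not_subset hJI] at hc ⊢
        exact Or.inl (Or.inl ⟨⟨⟨I, hI, rfl⟩, hc⟩, fun hs =>
          hJI (hF.subset_of_erase_ssubset hJ hJi (Or.inl hI) hs)⟩)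
    · exact Or.inr (insert_erase_eq J).symm
    · have hJF : J ∈ F :=
        hJ.mem_of_card (hc.trans_le (Finset.card_le_card (Finset.erase_subset i J)))
      exact Or.inl (Or.inl ⟨⟨⟨J, hJF, rfl⟩, hc⟩, fun h => h.2 le_rfl⟩)

theorem isNode_moveTeam_of_nonempty {X : Finset α} (hX : X.Nonempty)
    (h : (∃ I ∈ F, md i J I = X) ∨ X = insert i J ∨ X = J.erase i) :
    IsNode (moveTeam i J F) X := by
  rcases (Nat.succ_le_of_lt (Finset.card_pos.2 hX)).eq_or_lt with h1 | h1
  · exact Or.inr (Finset.card_eq_one.1 h1.symm)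
  · exact Or.inl (mem_moveTeam.2 ⟨h, h1⟩)

theorem IsNode.md_moveTeam (hJ : J.Nonempty) {X : Finset α} (hX : IsNode F X)
    (hne : (md i J X).Nonempty) : IsNode (moveTeam i J F) (md i J X) := by
  rcases hX with hX | ⟨x, rfl⟩
  · exact isNode_moveTeam_of_nonempty hne (Or.inl ⟨X, hX, rfl⟩)
  · by_cases h : J ⊆ {x}
    · rw [md_of_subset h]
      rw [(Finset.subset_singleton_iff.1 h).resolve_left hJ.ne_empty]
      exact isNode_moveTeam_of_nonempty (Finset.insert_nonempty _ _) (Or.inr (Or.inl rfl))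
    · rw [md_of_not_subset h] at hne ⊢
      refine Or.inr ⟨x, ?_⟩
      exact (Finset.subset_singleton_iff.1 (Finset.erase_subset i {x})).resolve_left hne.ne_empty

/-- A game of more than one team besides `i` can be replaced, up to team `i`, by one neither side
of which is the single team `i`: if `i` plays its first game in `I`, the other side serves. -/
theorem IsMaxCommutingFamily.exists_split_erase (hF : IsMaxCommutingFamily F) {I : Finset α}
    (hI : I ∈ F) (hc : 1 < (I.erase i).card) :
    ∃ I' ∈ F, I' ⊆ I ∧ I'.erase i = I.erase i ∧ ∃ X ⊆ I', IsNode F X ∧ IsNode F (I' \ X) ∧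
      (X.erase i).Nonempty ∧ ((I' \ X).erase i).Nonempty := by
  -- if `I.erase i` itself is a game, none of its sides contains `i`
  have hgood : I.erase i ∈ F → ∃ I' ∈ F, I' ⊆ I ∧ I'.erase i = I.erase i ∧
      ∃ X ⊆ I', IsNode F X ∧ IsNode F (I' \ X) ∧
      (X.erase i).Nonempty ∧ ((I' \ X).erase i).Nonempty := by
    intro hmem
    obtain ⟨X, hXI, hX, hX'⟩ := hF.exists_split hmem
    have hi : i ∉ I.erase i := Finset.notMem_erase i I
    refine ⟨I.erase i, hmem, Finset.erase_subset i I, by simp, X, hXI, hX, hX', ?_, ?_⟩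
    · rw [Finset.erase_eq_of_notMem fun h => hi (hXI h)]
      exact hF.prop.node_nonempty hX
    · rw [Finset.erase_eq_of_notMem fun h => hi (Finset.sdiff_subset h)]
      exact hF.prop.node_nonempty hX'
  obtain ⟨X, hXI, hX, hX'⟩ := hF.exists_split hI
  have hsing : ∀ Y, IsNode F Y → Y.erase i = ∅ → Y = {i} := by
    intro Y hY h
    refine (Finset.subset_singleton_iff.1 ?_).resolve_left (hF.prop.node_nonempty hY).ne_empty
    intro y hy
    by_contra hyi
    have : y ∈ Y.erase i := Finset.mem_erase.2 ⟨by simpa using hyi, hy⟩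
    simp [h] at this
  rcases Finset.eq_empty_or_nonempty (X.erase i) with h1 | h1
  · refine hgood (IsNode.mem_of_card ?_ hc)
    rw [hsing X hX h1] at hX'
    rwa [Finset.erase_eq]
  rcases Finset.eq_empty_or_nonempty ((I \ X).erase i) with h2 | h2
  · refine hgood (IsNode.mem_of_card ?_ hc)
    rw [Finset.erase_eq, ← hsing _ hX' h2, Finset.sdiff_sdiff_eq_self hXI]
    exact hX
  · exact ⟨I, hI, Finset.Subset.rfl, rfl, X, hXI, hX, hX', h1, h2⟩

theorem IsMaxCommutingFamily.moveTeam_split_erase (hF : IsMaxCommutingFamily F)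
    (hJ : J.Nonempty) {I : Finset α} (hI : I ∈ F) (h : ∀ X, X ⊂ I → ¬ J ⊆ X)
    (hc : 1 < (I.erase i).card) : ∃ Y ⊆ I.erase i, IsNode (moveTeam i J F) Y ∧
      IsNode (moveTeam i J F) (I.erase i \ Y) := by
  obtain ⟨I', -, hI'I, he, X, hXI', hX, hX', hne, hne'⟩ := hF.exists_split_erase hI hc
  have h1 : ¬ J ⊆ X := by
    refine h X (lt_of_lt_of_le (lt_of_le_of_ne hXI' ?_) hI'I)
    rintro rfl
    simp at hne'
  have h2 : ¬ J ⊆ I' \ X :=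
    h _ (lt_of_lt_of_le (Finset.sdiff_ssubset hXI' (hF.prop.node_nonempty hX)) hI'I)
  refine ⟨X.erase i, he ▸ Finset.erase_subset_erase i hXI', ?_, ?_⟩
  · rw [← md_of_not_subset h1] at hne ⊢
    exact hX.md_moveTeam hJ hne
  · have : I.erase i \ X.erase i = (I' \ X).erase i := by
      rw [← he]
      ext x
      by_cases hx : x = i <;> simp [hx]
    rw [this]
    rw [← md_of_not_subset h2] at hne' ⊢
    exact hX'.md_moveTeam hJ hne'

theorem IsMaxCommutingFamily.moveTeam_split_insert (hF : IsMaxCommutingFamily F)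
    (hJ : IsNode F J) (hJi : (J.erase i).Nonempty) {I : Finset α} (hI : I ∈ F)
    (hs : J.erase i ⊂ I.erase i) : ∃ Y ⊆ insert i I, IsNode (moveTeam i J F) Y ∧
      IsNode (moveTeam i J F) (insert i I \ Y) := by
  have hJne := hF.prop.node_nonempty hJ
  have hc : 1 < (I.erase i).card :=
    (Nat.succ_le_of_lt (Finset.card_pos.2 hJi)).trans_lt (Finset.card_lt_card hs)
  obtain ⟨I', hI'F, -, he, X, hXI', hX, hX', hne, hne'⟩ := hF.exists_split_erase hI hc
  have hs' : J.erase i ⊂ I'.erase i := he ▸ hs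
  have hJI' : J ⊂ I' := by
    refine lt_of_le_of_ne (hF.prop.subset_of_erase_ssubset hJ hJi (Or.inl hI'F) hs') ?_
    rintro rfl
    exact hs'.2 le_rfl
  rw [← insert_eq_of_erase_eq he]
  -- team `i` joins the side that contains `J`
  have key : ∀ Y ⊆ I', IsNode F Y → IsNode F (I' \ Y) → ((I' \ Y).erase i).Nonempty → J ⊆ Y →
      ∃ Y ⊆ insert i I', IsNode (moveTeam i J F) Y ∧
        IsNode (moveTeam i J F) (insert i I' \ Y) := by
    intro Y hYI' hY hY' hne' hJY
    have hJY' : ¬ J ⊆ I' \ Y := by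
      obtain ⟨x, hx⟩ := hJne
      exact fun h => (Finset.mem_sdiff.1 (h hx)).2 (hJY hx)
    refine ⟨insert i Y, Finset.insert_subset_insert i hYI', ?_, ?_⟩
    · rw [← md_of_subset hJY]
      exact hY.md_moveTeam hJne (by rw [md_of_subset hJY]; exact Finset.insert_nonempty _ _)
    · have : insert i I' \ insert i Y = (I' \ Y).erase i := by
        ext x
        by_cases hx : x = i <;> simp [hx]
      rw [this]
      rw [← md_of_not_subset hJY'] at hne' ⊢
      exact hY'.md_moveTeam hJne hne'
  rcases hF.prop.subset_side hJ hXI' hX hX' hJI' with h | h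
  · exact key X hXI' hX hX' hne' h
  · have hXX := Finset.sdiff_sdiff_eq_self hXI'
    exact key (I' \ X) Finset.sdiff_subset hX' (by rwa [hXX]) (by rwa [hXX]) h

theorem IsCommutingFamily.moveTeam (hF : IsCommutingFamily F) (hJ : IsNode F J) :
    IsCommutingFamily (moveTeam i J F) := by
  refine ⟨fun X hX => (mem_moveTeam.1 hX).2, fun X hX Y hY hne => ?_⟩
  have hcompat : Disjoint X Y ∨ X ⊆ Y ∨ Y ⊆ X := by
    have hswap : ∀ {X Y : Finset α}, (Disjoint X Y ∨ X ⊆ Y ∨ Y ⊆ X) →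
        (Disjoint Y X ∨ Y ⊆ X ∨ X ⊆ Y) := by
      rintro X Y (h | h | h)
      exacts [Or.inl h.symm, Or.inr (Or.inr h), Or.inr (Or.inl h)]
    have hJne := hF.node_nonempty hJ
    have hei : J.erase i ⊆ insert i J :=
      (Finset.erase_subset i J).trans (Finset.subset_insert i J)
    rcases (mem_moveTeam.1 hX).1 with ⟨I, hI, rfl⟩ | rfl | rfl
    · have hIJ := hF.compat_node (Or.inl hI) hJ
      rcases (mem_moveTeam.1 hY).1 with ⟨K, hK, rfl⟩ | rfl | rfl
      · exact md_compat hJne (hF.compat hI hK)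
      · exact md_compat_insert_of_compat hIJ
      · exact md_compat_erase_of_compat hIJ
    · rcases (mem_moveTeam.1 hY).1 with ⟨K, hK, rfl⟩ | rfl | rfl
      · exact hswap (md_compat_insert_of_compat (hF.compat_node (Or.inl hK) hJ))
      · exact Or.inr (Or.inl le_rfl)
      · exact Or.inr (Or.inr hei)
    · rcases (mem_moveTeam.1 hY).1 with ⟨K, hK, rfl⟩ | rfl | rfl
      · exact hswap (md_compat_erase_of_compat (hF.compat_node (Or.inl hK) hJ))
      · exact Or.inr (Or.inl hei)
      · exact Or.inr (Or.inl le_rfl)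
  rcases hcompat with h | h | h
  · exact Or.inl h
  · exact Or.inr (Or.inl (lt_of_le_of_ne h hne))
  · exact Or.inr (Or.inr (lt_of_le_of_ne h hne.symm))

theorem IsMaxCommutingFamily.moveTeam [Fintype α] (hF : IsMaxCommutingFamily F)
    (hα : 1 < Fintype.card α) (hJ : IsNode F J) (hJi : (J.erase i).Nonempty) :
    IsMaxCommutingFamily (moveTeam i J F) := by
  have hJne := hF.prop.node_nonempty hJ
  refine (hF.prop.moveTeam hJ).isMax_of_split ?_ fun X hX => ?_
  · refine mem_moveTeam.2 ⟨Or.inl ⟨Finset.univ, hF.univ_mem hα, ?_⟩, hα⟩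
    rw [md_of_subset (Finset.subset_univ J), Finset.insert_eq_of_mem (Finset.mem_univ i)]
  have hins : ∃ Y ⊆ insert i J, IsNode (KZ.moveTeam i J F) Y ∧
      IsNode (KZ.moveTeam i J F) (insert i J \ Y) := by
    refine ⟨{i}, by simp, Or.inr ⟨i, rfl⟩, ?_⟩
    have : insert i J \ {i} = J.erase i := by
      ext x
      by_cases hx : x = i <;> simp [hx]
    rw [this]
    exact isNode_moveTeam_of_nonempty hJi (Or.inr (Or.inr rfl))
  obtain ⟨⟨I, hI, rfl⟩ | rfl | rfl, hc⟩ := mem_moveTeam.1 hX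
  · by_cases hJI : J ⊆ I
    · rw [md_of_subset hJI]
      by_cases he : J.erase i = I.erase i
      · rw [← insert_eq_of_erase_eq he]
        exact hins
      · exact hF.moveTeam_split_insert hJ hJi hI
          (lt_of_le_of_ne (Finset.erase_subset_erase i hJI) he)
    · rw [md_of_not_subset hJI] at hc ⊢
      exact hF.moveTeam_split_erase hJne hI (fun X hX h => hJI (h.trans hX.subset)) hc
  · exact hins
  · have hJF : J ∈ F :=
      hJ.mem_of_card (hc.trans_le (Finset.card_le_card (Finset.erase_subset i J)))
    exact hF.moveTeam_split_erase hJne hJF (fun X hX h => hX.2 h) hc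

end Teams

/-! ### Sides of games and the admissible order -/

section Sides

variable {m : ℕ} {F : Finset (Finset (Fin (m + 1)))}
  {b : Finset (Fin (m + 1)) → Finset (Fin (m + 1))}

theorem IsMaxCommutingFamily.exists_isLosingSide (hF : IsMaxCommutingFamily F) :
    ∃ b, IsLosingSide F b := by
  have h : ∀ I : Finset (Fin (m + 1)), ∃ X : Finset (Fin (m + 1)), I ∈ F →
      X ⊆ I ∧ IsNode F X ∧ IsNode F (I \ X) ∧ 0 ∉ X := by
    intro I
    by_cases hI : I ∈ F
    · obtain ⟨X, hXI, hX, hX'⟩ := hF.exists_split hI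
      by_cases h0 : 0 ∈ X
      · exact ⟨I \ X, fun _ => ⟨Finset.sdiff_subset, hX',
          by rwa [Finset.sdiff_sdiff_eq_self hXI], fun h => (Finset.mem_sdiff.1 h).2 h0⟩⟩
      · exact ⟨X, fun _ => ⟨hXI, hX, hX', h0⟩⟩
    · exact ⟨∅, fun h => absurd h hI⟩
  choose b hb using h
  exact ⟨b, fun I hI => hb I hI⟩

/-- Passing to a larger set that does not contain `0` does not change the level. -/
theorem IsCommutingFamily.level_le_of_notMem (hF : IsCommutingFamily F)
    {I K : Finset (Fin (m + 1))} (hI : IsNode F I) (hK : IsNode F K) (h : K ⊆ I) (h0 : 0 ∉ I) :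
    level F I ≤ level F K := by
  refine Finset.card_le_card fun G hG => ?_
  simp only [Finset.mem_filter] at hG ⊢
  refine ⟨hG.1, hG.2.1, fun hKG => hG.2.2 ?_⟩
  rcases hF.compat_node hI (Or.inl hG.1) with h' | h' | h'
  · obtain ⟨x, hx⟩ := hF.node_nonempty hK
    exact absurd (hKG hx) (Finset.disjoint_left.1 h' (h hx))
  · exact h'
  · exact absurd (h' hG.2.1) h0

theorem level_lt_of_not_subset {I G K : Finset (Fin (m + 1))} (hI : I ∈ F) (h0 : 0 ∈ I)
    (hGI : G ⊆ I) (hK : ¬ K ⊆ I) (hcompat : ∀ H ∈ F, 0 ∈ H → I ⊆ H ∨ H ⊆ I) :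
    level F G < level F K := by
  refine Finset.card_lt_card ⟨fun H hH => ?_, fun hle => ?_⟩
  · simp only [Finset.mem_filter] at hH ⊢
    refine ⟨hH.1, hH.2.1, fun hKH => ?_⟩
    rcases hcompat H hH.1 hH.2.1 with h | h
    · exact hH.2.2 (hGI.trans h)
    · exact hK (hKH.trans h)
  · have : I ∈ F.filter fun H => 0 ∈ H ∧ ¬ G ⊆ H :=
      hle (Finset.mem_filter.2 ⟨hI, h0, hK⟩)
    exact (Finset.mem_filter.1 this).2.2 hGI

theorem IsOrdering.lt_of_level_lt {E : Fin m → Finset (Fin (m + 1))} (hE : IsOrdering F E)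
    {q k : Fin m} (h : level F (E q) < level F (E k)) : q < k := by
  by_contra hle
  rcases (not_lt.1 hle).eq_or_lt with rfl | hlt
  · exact lt_irrefl _ h
  · rcases hE.ordered k q hlt with h' | h'
    · exact lt_asymm h h'
    · exact h.ne' h'.1

theorem IsOrdering.lt_of_ssubset {E : Fin m → Finset (Fin (m + 1))} (hE : IsOrdering F E)
    (hne : ∀ a, (E a).Nonempty) {q k : Fin m} (h : level F (E q) ≤ level F (E k))
    (hs : E k ⊂ E q) : q < k := by
  by_contra hle
  rcases (not_lt.1 hle).eq_or_lt with rfl | hlt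
  · exact hs.2 le_rfl
  · rcases hE.ordered k q hlt with h' | ⟨-, h' | h'⟩
    · exact absurd h (not_le.2 h')
    · exact hs.2 h'
    · obtain ⟨x, hx⟩ := hne k
      exact Finset.disjoint_left.1 h' hx (hs.subset hx)

end Sides

/-! ### The flag spanned by the losing sides -/

section Flag

variable {m N : ℕ} {F : Finset (Finset (Fin (m + 1)))}
  {b : Finset (Fin (m + 1)) → Finset (Fin (m + 1))}

/-- The embedding `ι_S = ∑_{j ∈ S} ι_j` of `ℂ^N`, with values in tuples of vectors. As
there is no row `0`, it makes no difference whether `0 ∈ S`. -/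
def tupleOn (N : ℕ) (S : Finset (Fin (m + 1))) : (Fin N → ℂ) →ₗ[ℂ] (Fin m → Fin N → ℂ) :=
  LinearMap.pi fun r => if r.succ ∈ S then LinearMap.id else 0

theorem tupleOn_apply (S : Finset (Fin (m + 1))) (v : Fin N → ℂ) (r : Fin m) :
    tupleOn N S v r = if r.succ ∈ S then v else 0 := by
  unfold tupleOn
  split_ifs with h <;> simp [h]

theorem tupleOn_add_of_disjoint {S T : Finset (Fin (m + 1))} (h : Disjoint S T)
    (v : Fin N → ℂ) : tupleOn N S v + tupleOn N T v = tupleOn N (S ∪ T) v := by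
  funext r
  have : r.succ ∈ S → r.succ ∉ T := fun hS => Finset.disjoint_left.1 h hS
  simp only [Pi.add_apply, tupleOn_apply, Finset.mem_union]
  by_cases h1 : r.succ ∈ S <;> by_cases h2 : r.succ ∈ T <;> simp_all

/-- The sum of the images of `ι_{b(Q)}` for `Q` in a set of games. -/
def sideSpan (N : ℕ) (b : Finset (Fin (m + 1)) → Finset (Fin (m + 1)))
    (Q : Set (Finset (Fin (m + 1)))) : Submodule ℂ (Fin m → Fin N → ℂ) :=
  ⨆ I ∈ Q, LinearMap.range (tupleOn N (b I))

theorem sideSpan_mono {Q Q' : Set (Finset (Fin (m + 1)))} (h : Q ⊆ Q') :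
    sideSpan N b Q ≤ sideSpan N b Q' :=
  biSup_mono h

theorem tupleOn_mem_sideSpan {Q : Set (Finset (Fin (m + 1)))} {I : Finset (Fin (m + 1))}
    (h : I ∈ Q) (v : Fin N → ℂ) : tupleOn N (b I) v ∈ sideSpan N b Q :=
  Submodule.mem_iSup_of_mem I (Submodule.mem_iSup_of_mem h ⟨v, rfl⟩)

/-- For a node `X` not containing `0`, the map `ι_X` is a combination of the `ι_{b(Q)}`, where `Q`
runs through the games of the same level properly containing `X`: if `P` is the next game of the
winner of `X`, then `X = b(P)` or `ι_X = ι_P - ι_{b(P)}`, and in the latter case `0 ∉ P`. -/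
theorem IsLosingSide.tupleOn_mem_of_notMem (hb : IsLosingSide F b) (hF : IsCommutingFamily F)
    (huniv : Finset.univ ∈ F) {X : Finset (Fin (m + 1))} (hX : IsNode F X) (h0 : 0 ∉ X)
    (v : Fin N → ℂ) :
    tupleOn N X v ∈ sideSpan N b {Q | Q ∈ F ∧ X ⊂ Q ∧ level F Q ≤ level F X} := by
  induction hn : Xᶜ.card using Nat.strong_induction_on generalizing X with
  | _ n ih =>
  have hT : (F.filter fun I => X ⊂ I).Nonempty := by
    refine ⟨Finset.univ, Finset.mem_filter.2 ⟨huniv, Finset.subset_univ X, fun h => h0 ?_⟩⟩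
    exact h (Finset.mem_univ 0)
  obtain ⟨P, hPT, hmin⟩ := Finset.exists_min_image _ Finset.card hT
  obtain ⟨hP, hXP⟩ := Finset.mem_filter.1 hPT
  obtain ⟨hbP, hb1, hb2, hb0⟩ := hb P hP
  have hXne := hF.node_nonempty hX
  have hlevel : level F P ≤ level F X := by
    refine Finset.card_le_card fun G hG => ?_
    simp only [Finset.mem_filter] at hG ⊢
    refine ⟨hG.1, hG.2.1, fun hXG => hG.2.2 ?_⟩
    have hXG' : X ⊂ G := lt_of_le_of_ne hXG fun h => h0 (h ▸ hG.2.1)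
    rcases hF.compat hP hG.1 with h | h | h
    · obtain ⟨x, hx⟩ := hXne
      exact absurd (hXG hx) (Finset.disjoint_left.1 h (hXP.subset hx))
    · exact h
    · have := hmin G (Finset.mem_filter.2 ⟨hG.1, hXG'⟩)
      rw [Finset.eq_of_subset_of_card_le h this]
  have hPmem : P ∈ {Q | Q ∈ F ∧ X ⊂ Q ∧ level F Q ≤ level F X} := ⟨hP, hXP, hlevel⟩
  -- by minimality of `P`, the node `X` is one of the sides of `P`
  have hside : ∀ Y, IsNode F Y → X ⊆ Y → Y ⊂ P → X = Y := by
    intro Y hY hXY hYP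
    by_contra hne
    have hXY' : X ⊂ Y := lt_of_le_of_ne hXY hne
    have hYF : Y ∈ F := hY.mem_of_card
      ((Nat.succ_le_of_lt (Finset.card_pos.2 hXne)).trans_lt (Finset.card_lt_card hXY'))
    exact absurd (hmin Y (Finset.mem_filter.2 ⟨hYF, hXY'⟩))
      (not_le.2 (Finset.card_lt_card hYP))
  rcases hF.subset_side hX hbP hb1 hb2 hXP with h | h
  · have hbP' : b P ⊂ P := by
      refine lt_of_le_of_ne hbP fun h' => ?_
      have := hF.node_nonempty hb2
      rw [h', Finset.sdiff_self] at this
      exact Finset.not_nonempty_empty this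
    rw [hside _ hb1 h hbP']
    rw [hside _ hb1 h hbP'] at hPmem
    exact tupleOn_mem_sideSpan hPmem v
  · have hXeq := hside _ hb2 h (Finset.sdiff_ssubset hbP (hF.node_nonempty hb1))
    have h0P : 0 ∉ P := fun h => h0 (hXeq ▸ Finset.mem_sdiff.2 ⟨h, hb0⟩)
    have hsum : tupleOn N X v = tupleOn N P v - tupleOn N (b P) v := by
      rw [eq_sub_iff_add_eq, hXeq, tupleOn_add_of_disjoint Finset.sdiff_disjoint,
        Finset.sdiff_union_of_subset hbP]
    rw [hsum]
    refine Submodule.sub_mem _ ?_ (tupleOn_mem_sideSpan hPmem v)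
    have hlt : Pᶜ.card < n := hn ▸ Finset.card_lt_card (Finset.compl_ssubset_compl.2 hXP)
    refine sideSpan_mono ?_ (ih _ hlt (Or.inl hP) h0P rfl)
    exact fun Q hQ => ⟨hQ.1, hXP.trans hQ.2.1, hQ.2.2.trans hlevel⟩

/-- For a game `I` of team `0`, the set `I ∖ {0}` is the disjoint union of the losing sides of the
games of team `0` up to `I`. -/
theorem IsLosingSide.tupleOn_mem_of_mem (hb : IsLosingSide F b) (hF : IsCommutingFamily F)
    {I : Finset (Fin (m + 1))} (hI : I ∈ F) (h0 : 0 ∈ I) (v : Fin N → ℂ) :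
    tupleOn N I v ∈ sideSpan N b {G | G ∈ F ∧ G ⊆ I ∧ 0 ∈ G} := by
  induction hn : I.card using Nat.strong_induction_on generalizing I with
  | _ n ih =>
  obtain ⟨hbI, hb1, hb2, hb0⟩ := hb I hI
  have h0' : 0 ∈ I \ b I := Finset.mem_sdiff.2 ⟨h0, hb0⟩
  have hsum : tupleOn N I v = tupleOn N (b I) v + tupleOn N (I \ b I) v := by
    rw [tupleOn_add_of_disjoint Finset.disjoint_sdiff, Finset.union_sdiff_of_subset hbI]
  rw [hsum]
  have hmem : I ∈ {G | G ∈ F ∧ G ⊆ I ∧ 0 ∈ G} := ⟨hI, Finset.Subset.rfl, h0⟩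
  refine Submodule.add_mem _ (tupleOn_mem_sideSpan hmem v) ?_
  rcases hb2 with hb2 | ⟨j, hj⟩
  · have hne := hF.node_nonempty hb1
    have hlt : (I \ b I).card < n := hn ▸ Finset.card_lt_card (Finset.sdiff_ssubset hbI hne)
    refine sideSpan_mono ?_ (ih _ hlt hb2 h0' rfl)
    exact fun G hG => ⟨hG.1, hG.2.1.trans Finset.sdiff_subset, hG.2.2⟩
  · have : tupleOn N (I \ b I) v = 0 := by
      rw [hj] at h0' ⊢
      funext r
      rw [tupleOn_apply, if_neg]
      · rfl
      · rw [← Finset.mem_singleton.1 h0']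
        simp
    rw [this]
    exact Submodule.zero_mem _

end Flag

/-! ### Simultaneous triangular form -/

section Triangular

variable {m N : ℕ} {A : Fin (m + 1) → Fin (m + 1) → Matrix (Fin N) (Fin N) ℂ} {μ : ℂ}
  {F : Finset (Finset (Fin (m + 1)))} {E : Fin m → Finset (Fin (m + 1))}
  {b : Finset (Fin (m + 1)) → Finset (Fin (m + 1))}

theorem toLin'_shifted (A : Fin (m + 1) → Fin (m + 1) → Matrix (Fin N) (Fin N) ℂ) (μ : ℂ)
    (K I : Finset (Fin (m + 1))) :
    Matrix.toLin' (shifted A μ K I) = if K ⊆ I then upEnd A μ I else downEnd A I := by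
  unfold shifted md me upEnd downEnd
  by_cases hK : K ⊆ I <;> by_cases h0 : 0 ∈ I <;> simp [hK, h0]

theorem sumZero_tupleOn (X : Finset (Fin m)) (S : Finset (Fin (m + 1))) (v : Fin N → ℂ) :
    sumZero A X (tupleOn N S v) = ∑ j ∈ X with j.succ ∈ S, zeroEnd A j v := by
  rw [sumZero_apply, Finset.sum_filter]
  refine Finset.sum_congr rfl fun j _ => ?_
  rw [tupleOn_apply]
  split_ifs <;> simp

theorem commonRow_tupleOn_eq_zero {I S : Finset (Fin (m + 1))}
    (h : (0 ∈ I ∧ S ⊆ I) ∨ (0 ∉ I ∧ Disjoint S I)) (v : Fin N → ℂ) :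
    commonRow A I (tupleOn N S v) = 0 := by
  unfold commonRow
  rcases h with ⟨h0, h⟩ | ⟨h0, h⟩
  · rw [if_pos h0, sumZero_tupleOn, Finset.sum_eq_zero]
    intro j hj
    simp only [Finset.mem_filter, Finset.mem_compl, mem_tail] at hj
    exact absurd (h hj.2) hj.1
  · rw [if_neg h0, LinearMap.neg_apply, sumZero_tupleOn, Finset.sum_eq_zero, neg_zero]
    intro j hj
    simp only [Finset.mem_filter, mem_tail] at hj
    exact absurd hj.1 (Finset.disjoint_left.1 h hj.2)

/-- Modulo the losing sides of games that come earlier, `Ã_I` acts on the losing side of the game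
`K` by `A_I^K`. The three cases are `K ⊆ I`, `I ⊆ b(K)`, and `I` disjoint from `b(K)`. -/
theorem IsLosingSide.convEnd_tupleOn_sub_mem (hA : ∀ i j, A i j = A j i)
    (hb : IsLosingSide F b) (hF : IsCommutingFamily F) (huniv : Finset.univ ∈ F)
    {I K : Finset (Fin (m + 1))} (hI : I ∈ F) (hK : K ∈ F) (v : Fin N → ℂ) :
    convEnd A μ I (tupleOn N (b K) v) -
        tupleOn N (b K) (Matrix.toLin' (shifted A μ K I) v) ∈
      sideSpan N b {Q | Q ∈ F ∧ ((K ⊂ Q ∧ level F Q ≤ level F K) ∨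
        level F Q < level F K)} := by
  obtain ⟨hbK, hb1, hb2, hb0⟩ := hb K hK
  rw [toLin'_shifted]
  by_cases hKI : K ⊆ I
  · have hbI := hbK.trans hKI
    rw [if_pos hKI]
    have hdiff : convEnd A μ I (tupleOn N (b K) v) - tupleOn N (b K) (upEnd A μ I v) =
        tupleOn N I (commonRow A I (tupleOn N (b K) v)) := by
      funext r
      rw [Pi.sub_apply, tupleOn_apply I, tupleOn_apply (b K) (upEnd A μ I v)]
      by_cases hr : r.succ ∈ I
      · rw [convEnd_of_mem A μ hr, tupleOn_apply, if_pos hr]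
        split_ifs <;> simp
      · have hr' : r.succ ∉ b K := fun h => hr (hbI h)
        rw [convEnd_of_notMem A μ hr, tupleOn_apply, if_neg hr, if_neg hr', if_neg hr']
        simp
    rw [hdiff]
    by_cases h0 : 0 ∈ I
    · rw [commonRow_tupleOn_eq_zero (Or.inl ⟨h0, hbI⟩), map_zero]
      exact Submodule.zero_mem _
    · refine sideSpan_mono ?_ (hb.tupleOn_mem_of_notMem hF huniv (Or.inl hI) h0 _)
      exact fun Q hQ => ⟨hQ.1, Or.inl ⟨lt_of_le_of_lt hKI hQ.2.1,
        hQ.2.2.trans (hF.level_le_of_notMem (Or.inl hI) (Or.inl hK) hKI h0)⟩⟩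
  rw [if_neg hKI]
  have hcase : Disjoint (b K) I ∨ I ⊆ b K := by
    rcases hF.compat hK hI with h | h | h
    · exact Or.inl (h.mono_left hbK)
    · exact absurd h hKI
    · have hs : I ⊂ K := ⟨h, hKI⟩
      rcases hF.subset_side (Or.inl hI) hbK hb1 hb2 hs with h' | h'
      · exact Or.inr h'
      · exact Or.inl (Finset.disjoint_sdiff.mono_right h')
  rcases hcase with hd | hsub
  · have hdiff : convEnd A μ I (tupleOn N (b K) v) - tupleOn N (b K) (downEnd A I v) =
        tupleOn N I (commonRow A I (tupleOn N (b K) v)) := by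
      funext r
      rw [Pi.sub_apply, tupleOn_apply I, tupleOn_apply (b K) (downEnd A I v)]
      by_cases hr : r.succ ∈ I
      · have hr' : r.succ ∉ b K := Finset.disjoint_right.1 hd hr
        rw [convEnd_of_mem A μ hr, tupleOn_apply, if_neg hr', if_neg hr', if_pos hr]
        simp
      · rw [convEnd_of_notMem A μ hr, tupleOn_apply, if_neg hr]
        split_ifs <;> simp
    rw [hdiff]
    by_cases h0 : 0 ∈ I
    · refine sideSpan_mono ?_ (hb.tupleOn_mem_of_mem hF hI h0 _)
      refine fun G hG => ⟨hG.1, Or.inr (level_lt_of_not_subset hI h0 hG.2.1 hKI ?_)⟩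
      intro H hH h0H
      rcases hF.compat hI hH with h | h
      · exact absurd h0H (Finset.disjoint_left.1 h h0)
      · exact h
    · rw [commonRow_tupleOn_eq_zero (Or.inr ⟨h0, hd⟩), map_zero]
      exact Submodule.zero_mem _
  · have h0 : 0 ∉ I := fun h => hb0 (hsub h)
    have hzero : convEnd A μ I (tupleOn N (b K) v) - tupleOn N (b K) (downEnd A I v) = 0 := by
      funext r
      rw [Pi.sub_apply, tupleOn_apply (b K) (downEnd A I v)]
      by_cases hr : r.succ ∈ I
      · have hfilter : (tail I).filter (fun j => j.succ ∈ b K) = tail I :=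
          Finset.filter_true_of_mem fun j hj => hsub (mem_tail.1 hj)
        rw [convEnd_of_mem A μ hr, tupleOn_apply, if_pos (hsub hr), if_pos (hsub hr),
          upEnd_eq μ hA, commonRow, if_neg h0, if_neg h0, LinearMap.neg_apply,
          sumZero_tupleOn, hfilter]
        simp
      · rw [convEnd_of_notMem A μ hr, tupleOn_apply]
        split_ifs <;> simp
    rw [hzero]
    exact Submodule.zero_mem _

/-- The map with matrix `U` on tuples of vectors: `x ↦ ∑_a ι_{b(E a)} x_a`. -/
def sideSum (N : ℕ) (E : Fin m → Finset (Fin (m + 1)))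
    (b : Finset (Fin (m + 1)) → Finset (Fin (m + 1))) : Module.End ℂ (Fin m → Fin N → ℂ) :=
  ∑ a, tupleOn N (b (E a)) ∘ₗ LinearMap.proj a

theorem sideSum_apply (x : Fin m → Fin N → ℂ) :
    sideSum N E b x = ∑ a, tupleOn N (b (E a)) (x a) := by
  simp [sideSum]

theorem sideSum_single (a : Fin m) (v : Fin N → ℂ) :
    sideSum N E b (Pi.single a v) = tupleOn N (b (E a)) v := by
  rw [sideSum_apply, Finset.sum_eq_single a]
  · simp
  · intro c _ hc
    simp [hc]
  · simp

theorem exists_sideSum_of_mem_sideSpan {Q : Set (Finset (Fin (m + 1)))}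
    (hQ : ∀ I ∈ Q, ∃ a, E a = I) {y : Fin m → Fin N → ℂ} (hy : y ∈ sideSpan N b Q) :
    ∃ x, sideSum N E b x = y ∧ ∀ a, E a ∉ Q → x a = 0 := by
  let P : Submodule ℂ (Fin m → Fin N → ℂ) :=
    { carrier := {x | ∀ a, E a ∉ Q → x a = 0}
      add_mem' := fun hx hy a ha => by simp [hx a ha, hy a ha]
      zero_mem' := fun a _ => rfl
      smul_mem' := fun c x hx a ha => by simp [hx a ha] }
  have hle : sideSpan N b Q ≤ P.map (sideSum N E b) := by
    refine iSup₂_le fun I hI => ?_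
    rintro _ ⟨v, rfl⟩
    obtain ⟨a, rfl⟩ := hQ I hI
    refine ⟨Pi.single a v, fun c hc => ?_, sideSum_single a v⟩
    have : c ≠ a := fun h => hc (h ▸ hI)
    simp [this]
  obtain ⟨x, hx, rfl⟩ := hle hy
  exact ⟨x, rfl, hx⟩

theorem sideSum_surjective (hb : IsLosingSide F b) (hF : IsCommutingFamily F)
    (huniv : Finset.univ ∈ F) (hE : IsOrdering F E) :
    Function.Surjective (sideSum N E b) := by
  intro w
  have hw : w ∈ sideSpan N b {Q | Q ∈ F} := by
    have hsum : w = ∑ j : Fin m, tupleOn N {j.succ} (w j) := by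
      funext r
      rw [Finset.sum_apply, Finset.sum_eq_single r]
      · simp [tupleOn_apply]
      · intro j _ hj
        simp [tupleOn_apply, hj.symm]
      · simp
    rw [hsum]
    refine Submodule.sum_mem _ fun j _ => ?_
    refine sideSpan_mono (fun Q hQ => hQ.1) (hb.tupleOn_mem_of_notMem hF huniv
      (Or.inr ⟨j.succ, rfl⟩) ?_ (w j))
    simpa using (Fin.succ_ne_zero j).symm
  obtain ⟨x, hx, -⟩ := exists_sideSum_of_mem_sideSpan (fun I hI => (hE.mem_iff I).1 hI) hw
  exact ⟨x, hx⟩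

theorem sideSum_bijective (hb : IsLosingSide F b) (hF : IsCommutingFamily F)
    (huniv : Finset.univ ∈ F) (hE : IsOrdering F E) :
    Function.Bijective (sideSum N E b) :=
  ⟨LinearMap.injective_iff_surjective.2 (sideSum_surjective hb hF huniv hE),
    sideSum_surjective hb hF huniv hE⟩

/-- In the coordinates given by the losing sides, listed in an admissible order, all `Ã_{E a}` are
upper triangular. -/
theorem isTriangular_of_sideSum (hA : ∀ i j, A i j = A j i) (hb : IsLosingSide F b)
    (hF : IsCommutingFamily F) (huniv : Finset.univ ∈ F) (hE : IsOrdering F E)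
    (a : Fin m) {B : Module.End ℂ (Fin m → Fin N → ℂ)}
    (hB : ∀ x, sideSum N E b (B x) = convEnd A μ (E a) (sideSum N E b x)) :
    IsTriangular B fun k => shiftedFamily A μ E (E k) a := by
  have hmem : ∀ k, E k ∈ F := fun k => (hE.mem_iff _).2 ⟨k, rfl⟩
  have key : ∀ k l v, k ≤ l →
      B (Pi.single k v) l = if k = l then shiftedFamily A μ E (E k) a v else 0 := by
    intro k l v hkl
    have h1 := hb.convEnd_tupleOn_sub_mem (μ := μ) hA hF huniv (hmem a) (hmem k) v
    obtain ⟨x, hx, hx0⟩ := exists_sideSum_of_mem_sideSpan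
      (fun I hI => (hE.mem_iff I).1 hI.1) h1
    have h2 : B (Pi.single k v) = Pi.single k (shiftedFamily A μ E (E k) a v) + x := by
      apply (sideSum_bijective hb hF huniv hE).1
      rw [hB, map_add, hx, sideSum_single, sideSum_single]
      exact (add_sub_cancel _ _).symm
    have hxl : x l = 0 := by
      refine hx0 l ?_
      rintro ⟨-, ⟨hs, hle⟩ | hlt⟩
      · exact absurd (hE.lt_of_ssubset (fun c => hF.node_nonempty (Or.inl (hmem c))) hle hs)
          (not_lt.2 hkl)
      · exact absurd (hE.lt_of_level_lt hlt) (not_lt.2 hkl)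
    rw [h2, Pi.add_apply, hxl, add_zero]
    split_ifs with h
    · subst h; simp
    · simp [Ne.symm h]
  intro w k hw
  have hsum : w = ∑ l, Pi.single l (w l) := (Finset.univ_sum_single w).symm
  have h3 : B w k = ∑ l, B (Pi.single l (w l)) k := by
    conv_lhs => rw [hsum]
    rw [map_sum, Finset.sum_apply]
  rw [h3, Finset.sum_eq_single k]
  · rw [key k k _ le_rfl, if_pos rfl]
  · intro l _ hl
    rcases lt_or_gt_of_ne hl with h | h
    · rw [key l k _ h.le, if_neg hl]
    · simp [hw l h]
  · simp

theorem curry_basisChange_mulVec (w : Fin m × Fin N → ℂ) :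
    Function.curry (basisChange N E b *ᵥ w) = sideSum N E b (Function.curry w) := by
  funext r
  rw [basisChange, curry_comp_mulVec, sideSum_apply, Finset.sum_apply]
  refine Finset.sum_congr rfl fun c _ => ?_
  rw [Matrix.of_apply, tupleOn_apply]
  split_ifs <;> simp

theorem isUnit_basisChange (hb : IsLosingSide F b) (hF : IsCommutingFamily F)
    (huniv : Finset.univ ∈ F) (hE : IsOrdering F E) : IsUnit (basisChange N E b) := by
  rw [← Matrix.mulVec_injective_iff_isUnit]
  intro v w h
  have h' := congrArg Function.curry h
  simp only [curry_basisChange_mulVec] at h'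
  have h2 := (sideSum_bijective hb hF huniv hE).1 h'
  rw [← Function.uncurry_curry v, h2, Function.uncurry_curry]

theorem blockTriangular_basisChange (hA : ∀ i j, A i j = A j i) (hb : IsLosingSide F b)
    (hF : IsCommutingFamily F) (huniv : Finset.univ ∈ F) (hE : IsOrdering F E) (a : Fin m) :
    ((basisChange N E b)⁻¹ * residue (conv A μ) (E a) *
      basisChange N E b).BlockTriangular Prod.fst := by
  set M := (basisChange N E b)⁻¹ * residue (conv A μ) (E a) * basisChange N E b
  have hU : basisChange N E b * M = residue (conv A μ) (E a) * basisChange N E b := by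
    rw [show M = (basisChange N E b)⁻¹ * (residue (conv A μ) (E a) * basisChange N E b) from
      Matrix.mul_assoc _ _ _, Matrix.mul_nonsing_inv_cancel_left]
    exact (Matrix.isUnit_iff_isUnit_det _).1 (isUnit_basisChange hb hF huniv hE)
  let e := LinearEquiv.curry ℂ ℂ (Fin m) (Fin N)
  let B : Module.End ℂ (Fin m → Fin N → ℂ) :=
    e.toLinearMap ∘ₗ Matrix.toLin' M ∘ₗ e.symm.toLinearMap
  have hB : ∀ x, sideSum N E b (B x) = convEnd A μ (E a) (sideSum N E b x) := by
    intro x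
    have h1 : Function.curry (basisChange N E b *ᵥ (M *ᵥ Function.uncurry x)) =
        Function.curry (residue (conv A μ) (E a) *ᵥ
          (basisChange N E b *ᵥ Function.uncurry x)) := by
      rw [Matrix.mulVec_mulVec, Matrix.mulVec_mulVec, hU]
    rw [curry_basisChange_mulVec] at h1
    have h2 := curry_residue_conv μ hA (E a) (basisChange N E b *ᵥ Function.uncurry x)
    rw [curry_basisChange_mulVec, Function.curry_uncurry] at h2
    exact h1.trans h2
  have ht := isTriangular_of_sideSum hA hb hF huniv hE a hB
  rintro ⟨r, s⟩ ⟨c, t⟩ hrc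
  have h1 := ht (Pi.single c (Pi.single t 1)) r fun l hl => by
    simp [((show c < r from hrc).trans hl).ne']
  have h2 : (Pi.single c (Pi.single t 1) : Fin m → Fin N → ℂ) r = 0 := by
    simp [(show c < r from hrc).ne']
  rw [h2, map_zero] at h1
  have h3 : Function.uncurry (Pi.single c (Pi.single t 1) : Fin m → Fin N → ℂ) =
      Pi.single (c, t) 1 := by
    ext ⟨i, j⟩
    simp only [Function.uncurry, Pi.single_apply, Prod.mk.injEq]
    by_cases hi : i = c <;> simp [hi, Pi.single_apply]
  have h4 : B (Pi.single c (Pi.single t 1)) r s = (M *ᵥ Pi.single (c, t) 1) (r, s) := by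
    rw [← h3]; rfl
  rw [h1] at h4
  simpa using h4.symm

end Triangular

/-! ### Spectra of the convolution -/

section Spectrum

variable {m N : ℕ} {A : Fin (m + 1) → Fin (m + 1) → Matrix (Fin N) (Fin N) ℂ}
  {F : Finset (Finset (Fin (m + 1)))} {E : Fin m → Finset (Fin (m + 1))}

theorem IsKZType.commute_convFamily (hA : IsKZType A) (μ : ℂ) (hF : IsCommutingFamily F)
    (hE : ∀ a, E a ∈ F) (a a' : Fin m) :
    Commute (convFamily A μ E a) (convFamily A μ E a') := by
  have h : Commute (convEnd A μ (E a)) (convEnd A μ (E a')) := by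
    rcases hF.compat (hE a) (hE a') with h | h | h
    · exact hA.commute_convEnd_of_disjoint μ h
    · exact hA.commute_convEnd_of_le μ h
    · exact (hA.commute_convEnd_of_le μ h).symm
  exact commute_of_injective (f := (LinearEquiv.curry ℂ ℂ (Fin m) (Fin N)).toLinearMap)
    (LinearEquiv.curry ℂ ℂ (Fin m) (Fin N)).injective
    (fun w => (curry_residue_conv μ hA.symm (E a) w).symm)
    (fun w => (curry_residue_conv μ hA.symm (E a') w).symm) h

theorem IsKZType.commute_shiftedFamily (hA : IsKZType A) (μ : ℂ) (hF : IsCommutingFamily F)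
    (hE : ∀ a, E a ∈ F) {K : Finset (Fin (m + 1))} (hK : K.Nonempty) (a a' : Fin m) :
    Commute (shiftedFamily A μ E K a) (shiftedFamily A μ E K a') := by
  have h : Commute (residue A (md 0 K (E a))) (residue A (md 0 K (E a'))) := by
    rcases md_compat (i := 0) hK (hF.compat (hE a) (hE a')) with h | h | h
    · exact hA.commute_residue_of_disjoint h
    · exact hA.commute_residue_of_subset h
    · exact (hA.commute_residue_of_subset h).symm
  have h' : Commute (shifted A μ K (E a)) (shifted A μ K (E a')) :=
    (h.add_right ((Commute.one_right _).smul_right _)).add_left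
      ((Commute.one_left _).smul_left _)
  exact h'.map (Matrix.toLinAlgEquiv' (R := ℂ) (n := Fin N))

theorem IsKZType.isSpecUnion_convFamily (hA : IsKZType A) (μ : ℂ)
    (hF : IsMaxCommutingFamily F) (huniv : Finset.univ ∈ F) (hE : IsOrdering F E) :
    IsSpecUnion (convFamily A μ E) (fun a : Fin m => shiftedFamily A μ E (E a))
      (fun _ => 1) := by
  obtain ⟨b, hb⟩ := hF.exists_isLosingSide
  have hmem : ∀ k, E k ∈ F := fun k => (hE.mem_iff _).2 ⟨k, rfl⟩
  let U := LinearEquiv.ofBijective (sideSum N E b) (sideSum_bijective hb hF.prop huniv hE)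
  let e := LinearEquiv.curry ℂ ℂ (Fin m) (Fin N) ≪≫ₗ U.symm
  let B : Fin m → Module.End ℂ (Fin m → Fin N → ℂ) := fun a =>
    U.symm.toLinearMap ∘ₗ convEnd A μ (E a) ∘ₗ U.toLinearMap
  have hB : ∀ a x, sideSum N E b (B a x) = convEnd A μ (E a) (sideSum N E b x) :=
    fun a x => U.apply_symm_apply _
  have he : ∀ a x, B a (e x) = e (convFamily A μ E a x) := by
    intro a x
    apply U.injective
    have h1 : U (B a (e x)) = convEnd A μ (E a) (U (e x)) := hB a (e x)
    have h2 : ∀ y, U (e y) = Function.curry y := fun y => U.apply_symm_apply _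
    rw [h1, h2, h2]
    exact (curry_residue_conv μ hA.symm (E a) x).symm
  have htri := fun a => isTriangular_of_sideSum hA.symm hb hF.prop huniv hE a (hB a)
  have hc := hA.commute_convFamily μ hF.prop hmem
  refine IsSpecUnion.of_mult_of_aeval hc
    (fun k => hA.commute_shiftedFamily μ hF.prop hmem (hF.prop.node_nonempty (Or.inl (hmem k))))
    ?_ ?_
  · intro z
    rw [simSpec_eq_of_equiv e he z, simSpec_of_isTriangular
      (fun i j => commute_of_surjective (f := e.toLinearMap) e.surjective (he i) (he j)
        (hc i j)) htri z]
    simp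
  · intro a P hP
    simp only [one_ne_zero, if_false]
    exact (aeval_eq_zero_iff_of_equiv e (he a) _).2
      (aeval_eq_zero_of_isTriangular (htri a) hP)

theorem card_tail {I : Finset (Fin (m + 1))} : (tail I).card = (I.erase 0).card := by
  rw [← map_succEmb_tail, Finset.card_map]

/-- The spectrum of a single `Ã_I` with `0 ∈ I`: the tuples supported in the rows `r ∈ I` are
invariant. -/
theorem spectrum_convEnd_of_mem (A : Fin (m + 1) → Fin (m + 1) → Matrix (Fin N) (Fin N) ℂ)
    (μ : ℂ) {I : Finset (Fin (m + 1))} (h0 : 0 ∈ I) :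
    (∀ z : Unit → ℂ, simSpec (fun _ : Unit => convEnd A μ I) z =
      (I.card - 1) * simSpec (fun _ : Unit => upEnd A μ I) z +
      (m + 1 - I.card) * simSpec (fun _ : Unit => downEnd A I) z) ∧
    ∀ p q : Polynomial ℂ, Polynomial.aeval (upEnd A μ I) p = 0 →
      Polynomial.aeval (downEnd A I) q = 0 →
      Polynomial.aeval (convEnd A μ I) ((if I.card - 1 = 0 then 1 else p) *
        (if m + 1 - I.card = 0 then 1 else q)) = 0 := by
  let f : ({r // r ∈ tail I} → Fin N → ℂ) →ₗ[ℂ] (Fin m → Fin N → ℂ) :=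
    LinearMap.pi fun r => if h : r ∈ tail I then LinearMap.proj ⟨r, h⟩ else 0
  have hf : ∀ x r (h : r ∈ tail I), f x r = x ⟨r, h⟩ := by
    intro x r h
    change (if h : r ∈ tail I then LinearMap.proj ⟨r, h⟩ else 0 :
      ({r // r ∈ tail I} → Fin N → ℂ) →ₗ[ℂ] (Fin N → ℂ)) x = _
    rw [dif_pos h]; rfl
  have hf' : ∀ x r, r ∉ tail I → f x r = 0 := by
    intro x r h
    change (if h : r ∈ tail I then LinearMap.proj ⟨r, h⟩ else 0 :
      ({r // r ∈ tail I} → Fin N → ℂ) →ₗ[ℂ] (Fin N → ℂ)) x = _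
    rw [dif_neg h]; rfl
  let g : (Fin m → Fin N → ℂ) →ₗ[ℂ] ({r // r ∉ tail I} → Fin N → ℂ) :=
    LinearMap.funLeft ℂ (Fin N → ℂ) Subtype.val
  have key := spectrum_of_exact_diagonalEnd (B := convEnd A μ I) (C := upEnd A μ I)
    (D := downEnd A I) (f := f) (g := g) ?_
    (LinearMap.funLeft_surjective_of_injective _ _ _ Subtype.val_injective) ?_ ?_ ?_
  · have hc : Fintype.card {r // r ∈ tail I} = I.card - 1 := by
      rw [Fintype.card_coe, card_tail, Finset.card_erase_of_mem h0]
    have hc' : Fintype.card {r // r ∉ tail I} = m + 1 - I.card := by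
      have := Finset.card_pos.2 ⟨0, h0⟩
      rw [Fintype.card_subtype_compl, hc, Fintype.card_fin]
      omega
    rwa [hc, hc'] at key
  · intro x y hxy
    funext ⟨r, h⟩
    rw [← hf x r h, hxy, hf]
  · intro y
    constructor
    · intro hy
      refine ⟨fun r => y r, funext fun r => ?_⟩
      by_cases h : r ∈ tail I
      · rw [hf _ r h]
      · rw [hf' _ r h]
        exact (congrFun hy ⟨r, h⟩).symm
    · rintro ⟨x, rfl⟩
      funext ⟨r, h⟩
      exact hf' x r h
  · intro x
    have hrow : commonRow A I (f x) = 0 := by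
      rw [commonRow, if_pos h0, sumZero_apply]
      refine Finset.sum_eq_zero fun j hj => ?_
      rw [hf' x j (Finset.mem_compl.1 hj), map_zero]
    funext r
    by_cases h : r ∈ tail I
    · rw [convEnd_of_mem A μ (mem_tail.1 h), hrow, add_zero, hf _ r h, hf _ r h]
      rfl
    · rw [convEnd_of_notMem A μ (fun h' => h (mem_tail.2 h')), hf' _ r h, hf' _ r h, map_zero]
  · intro x
    funext ⟨r, h⟩
    exact (convEnd_of_notMem A μ (fun h' => h (mem_tail.2 h')) x).symm

/-- The spectrum of a single `Ã_I` with `0 ∉ I`: the tuples that are constant in the rows `r ∈ I`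
are invariant. The quotient is described by the differences with one of these rows. -/
theorem spectrum_convEnd_of_notMem (hA : ∀ i j, A i j = A j i) (μ : ℂ)
    {I : Finset (Fin (m + 1))} (h0 : 0 ∉ I) (hI : I.Nonempty) :
    (∀ z : Unit → ℂ, simSpec (fun _ : Unit => convEnd A μ I) z =
      (I.card - 1) * simSpec (fun _ : Unit => upEnd A μ I) z +
      (m + 1 - I.card) * simSpec (fun _ : Unit => downEnd A I) z) ∧
    ∀ p q : Polynomial ℂ, Polynomial.aeval (upEnd A μ I) p = 0 →
      Polynomial.aeval (downEnd A I) q = 0 →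
      Polynomial.aeval (convEnd A μ I) ((if I.card - 1 = 0 then 1 else p) *
        (if m + 1 - I.card = 0 then 1 else q)) = 0 := by
  have hcard : (tail I).card = I.card := by rw [card_tail, Finset.erase_eq_of_notMem h0]
  obtain ⟨r₀, hr₀⟩ : (tail I).Nonempty := Finset.card_pos.1 (hcard ▸ Finset.card_pos.2 hI)
  set T := (tail I).erase r₀ with hT
  have hr₀T : r₀ ∉ T := Finset.notMem_erase _ _
  have hTI : ∀ {r}, r ∈ T → r ∈ tail I := fun h => Finset.mem_of_mem_erase h
  let ρ : Fin m → {r // r ∉ T} := fun r => if h : r ∉ T then ⟨r, h⟩ else ⟨r₀, hr₀T⟩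
  have hρ : ∀ r (h : r ∉ T), ρ r = ⟨r, h⟩ := fun r h => dif_pos h
  have hρ' : ∀ r, r ∈ T → ρ r = ⟨r₀, hr₀T⟩ := fun r h => dif_neg (not_not.2 h)
  let f : ({r // r ∉ T} → Fin N → ℂ) →ₗ[ℂ] (Fin m → Fin N → ℂ) :=
    LinearMap.funLeft ℂ (Fin N → ℂ) ρ
  have hf : ∀ x r, f x r = x (ρ r) := fun _ _ => rfl
  let g : (Fin m → Fin N → ℂ) →ₗ[ℂ] ({r // r ∈ T} → Fin N → ℂ) :=
    LinearMap.pi fun r =>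
      (LinearMap.proj r.1 : (Fin m → Fin N → ℂ) →ₗ[ℂ] (Fin N → ℂ)) - LinearMap.proj r₀
  have hg : ∀ y r, g y r = y r.1 - y r₀ := fun _ _ => rfl
  have key := spectrum_of_exact_diagonalEnd (B := convEnd A μ I) (C := downEnd A I)
    (D := upEnd A μ I) (f := f) (g := g)
    (LinearMap.funLeft_injective_of_surjective _ _ _ fun r => ⟨r.1, hρ r.1 r.2⟩) ?_ ?_ ?_ ?_
  · have hc : Fintype.card {r // r ∈ T} = I.card - 1 := by
      rw [Fintype.card_coe, hT, Finset.card_erase_of_mem hr₀, hcard]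
    have hc' : Fintype.card {r // r ∉ T} = m + 1 - I.card := by
      have := Finset.card_pos.2 hI
      rw [Fintype.card_subtype_compl, hc, Fintype.card_fin]
      omega
    rw [hc, hc'] at key
    refine ⟨fun z => (key.1 z).trans (add_comm _ _), fun p q hp hq => ?_⟩
    rw [mul_comm]
    exact key.2 q p hq hp
  · intro y
    refine ⟨fun r => if h : r ∈ T then y ⟨r, h⟩ else 0, funext fun r => ?_⟩
    rw [hg]
    simp [hr₀T]
  · intro y
    constructor
    · intro hy
      refine ⟨fun r => y r.1, funext fun r => ?_⟩
      rw [hf]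
      by_cases h : r ∈ T
      · rw [hρ' r h]
        exact (sub_eq_zero.1 (congrFun hy ⟨r, h⟩)).symm
      · rw [hρ r h]
    · rintro ⟨x, rfl⟩
      funext ⟨r, h⟩
      rw [hg, hf, hf, hρ' r h, hρ r₀ hr₀T]
      exact sub_self _
  · intro x
    -- on the rows `r ∈ I` the tuple `f x` has the constant value `v`
    set v := x ⟨r₀, hr₀T⟩ with hv
    have hval : ∀ r ∈ tail I, f x r = v := by
      intro r hr
      rw [hf]
      by_cases h : r = r₀
      · rw [h, hρ r₀ hr₀T]
      · rw [hρ' r (Finset.mem_erase.2 ⟨h, hr⟩)]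
    have hrow : commonRow A I (f x) = -∑ j ∈ tail I, zeroEnd A j v := by
      rw [commonRow, if_neg h0, LinearMap.neg_apply, sumZero_apply]
      congr 1
      exact Finset.sum_congr rfl fun j hj => by rw [hval j hj]
    funext r
    rw [hf, diagonalEnd_apply, ← hf x r]
    by_cases h : r ∈ tail I
    · rw [convEnd_of_mem A μ (mem_tail.1 h), hrow, hval r h, upEnd_eq μ hA, if_neg h0]
      simp
    · rw [convEnd_of_notMem A μ (fun h' => h (mem_tail.2 h'))]
  · intro x
    funext ⟨r, h⟩
    rw [hg, diagonalEnd_apply, hg, convEnd_of_mem A μ (mem_tail.1 (hTI h)),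
      convEnd_of_mem A μ (mem_tail.1 hr₀), map_sub]
    abel

theorem isSpecUnion_residue_conv (hA : ∀ i j, A i j = A j i) (μ : ℂ)
    {I : Finset (Fin (m + 1))} (hI : I.Nonempty) :
    IsSpecUnion (fun _ : Unit => Matrix.toLin' (residue (conv A μ) I))
      (![fun _ => Matrix.toLin' (residue A (insert 0 I) +
            (if 0 ∈ I then μ else 0) • (1 : Matrix (Fin N) (Fin N) ℂ)),
        fun _ => Matrix.toLin' (residue A (I.erase 0))] :
          Fin 2 → Unit → Module.End ℂ (Fin N → ℂ))
      ![I.card - 1, m + 1 - I.card] := by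
  let e := LinearEquiv.curry ℂ ℂ (Fin m) (Fin N)
  have he : ∀ x, convEnd A μ I (e x) = e (Matrix.toLin' (residue (conv A μ) I) x) :=
    fun x => (curry_residue_conv μ hA I x).symm
  have key : (∀ z : Unit → ℂ, simSpec (fun _ : Unit => convEnd A μ I) z =
      (I.card - 1) * simSpec (fun _ : Unit => upEnd A μ I) z +
      (m + 1 - I.card) * simSpec (fun _ : Unit => downEnd A I) z) ∧
    ∀ p q : Polynomial ℂ, Polynomial.aeval (upEnd A μ I) p = 0 →
      Polynomial.aeval (downEnd A I) q = 0 →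
      Polynomial.aeval (convEnd A μ I) ((if I.card - 1 = 0 then 1 else p) *
        (if m + 1 - I.card = 0 then 1 else q)) = 0 := by
    by_cases h0 : 0 ∈ I
    · exact spectrum_convEnd_of_mem A μ h0
    · exact spectrum_convEnd_of_notMem hA μ h0 hI
  refine IsSpecUnion.of_mult_of_aeval (fun _ _ => Commute.refl _)
    (fun k _ _ => Commute.refl _) ?_ ?_
  · intro z
    rw [simSpec_eq_of_equiv e (fun _ => he) z, key.1 z, Fin.sum_univ_two]
    rfl
  · intro _ P hP
    rw [Fin.prod_univ_two, aeval_eq_zero_iff_of_equiv e he]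
    exact key.2 (P 0) (P 1) (hP 0) (hP 1)

end Spectrum

/-! ### Spectra on the kernels and of the middle convolution -/

section Kernels

open Module

theorem sameSpectrumOn_map {ι V W : Type*} [AddCommGroup V] [Module ℂ V] [AddCommGroup W]
    [Module ℂ W] {B : ι → End ℂ V} {C : ι → End ℂ W} (hB : ∀ i j, Commute (B i) (B j))
    {f : W →ₗ[ℂ] V} (hf : Function.Injective f) {Q : Submodule ℂ W} (hQ : IsInvariant C Q)
    (h : ∀ i, ∀ x ∈ Q, B i (f x) = f (C i x)) : SameSpectrumOn B (Q.map f) C Q := by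
  have hP : IsInvariant B (Q.map f) := by
    rintro i _ ⟨x, hx, rfl⟩
    exact ⟨C i x, hQ i x hx, (h i x hx).symm⟩
  let e := Submodule.equivMapOfInjective f hf Q
  have he : ∀ i x, restrictFamily B (Q.map f) hP i (e x) = e (restrictFamily C Q hQ i x) :=
    fun i x => Subtype.ext (h i x.1 x.2)
  have hcB : ∀ i j, Commute (restrictFamily B _ hP i) (restrictFamily B _ hP j) := fun i j =>
    commute_of_injective (f := (Q.map f).subtype) (Q.map f).injective_subtype (fun _ => rfl)
      (fun _ => rfl) (hB i j)
  exact ⟨hP, hQ, hcB,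
    fun i j => commute_of_injective (f := e.toLinearMap) e.injective (he i) (he j) (hcB i j),
    fun z => (simSpec_eq_of_equiv e he z).symm, fun S => (isSpectrum_iff_of_equiv e he S).symm⟩

variable {m N : ℕ} {A : Fin (m + 1) → Fin (m + 1) → Matrix (Fin N) (Fin N) ℂ} {μ : ℂ}
  {E : Fin m → Finset (Fin (m + 1))}

theorem mem_kerZero {j : Fin m} {v : Fin N → ℂ} : v ∈ kerZero A j ↔ zeroEnd A j v = 0 :=
  Iff.rfl

theorem curry_iota (j : Fin m) (v : Fin N → ℂ) :
    Function.curry (iota j v) = tupleOn N {j.succ} v := by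
  funext r
  rw [tupleOn_apply]
  ext s
  simp only [iota, Function.curry, LinearMap.coe_mk, AddHom.coe_mk, Finset.mem_singleton,
    Fin.succ_inj]
  split_ifs <;> rfl

theorem iota_injective (j : Fin m) : Function.Injective (iota (N := N) j) := by
  intro v w h
  have h' := congrFun (congrArg Function.curry h) j
  simpa [curry_iota, tupleOn_apply] using h'

theorem curry_injective : Function.Injective
    (Function.curry : (Fin m × Fin N → ℂ) → Fin m → Fin N → ℂ) :=
  (LinearEquiv.curry ℂ ℂ (Fin m) (Fin N)).injective

theorem convEnd_tupleOn_singleton {j : Fin m} {v : Fin N → ℂ} (hv : v ∈ kerZero A j)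
    (I : Finset (Fin (m + 1))) :
    convEnd A μ I (tupleOn N {j.succ} v) =
      tupleOn N {j.succ} (Matrix.toLin' (shifted A μ {j.succ} I) v) := by
  have hsum : ∀ X, sumZero A X (tupleOn N {j.succ} v) = 0 := by
    intro X
    rw [sumZero_tupleOn]
    refine Finset.sum_eq_zero fun k hk => ?_
    have : k = j := by simpa using (Finset.mem_filter.1 hk).2
    rw [this]
    exact hv
  have hrow : commonRow A I (tupleOn N {j.succ} v) = 0 := by
    unfold commonRow
    split_ifs
    · exact hsum _
    · rw [LinearMap.neg_apply, hsum, neg_zero]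
  rw [toLin'_shifted]
  simp only [Finset.singleton_subset_iff]
  funext r
  by_cases hr : r = j
  · subst hr
    by_cases h : r.succ ∈ I
    · rw [convEnd_of_mem A μ h, hrow]
      simp [tupleOn_apply, h]
    · rw [convEnd_of_notMem A μ h]
      simp [tupleOn_apply, h]
  · by_cases h : r.succ ∈ I
    · rw [convEnd_of_mem A μ h, hrow]
      simp [tupleOn_apply, hr]
    · rw [convEnd_of_notMem A μ h]
      simp [tupleOn_apply, hr]

theorem IsKZType.isInvariant_kerZero (hA : IsKZType A) (μ : ℂ)
    (E : Fin m → Finset (Fin (m + 1))) (j : Fin m) :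
    IsInvariant (shiftedFamily A μ E {j.succ}) (kerZero A j) := by
  intro a v hv
  rw [mem_kerZero] at hv ⊢
  unfold shiftedFamily
  rw [toLin'_shifted]
  simp only [Finset.singleton_subset_iff]
  split_ifs with h
  · have := LinearMap.congr_fun (hA.commute_zeroEnd_upEnd μ h).eq v
    simpa [hv] using this
  · have := LinearMap.congr_fun (hA.commute_zeroEnd_downEnd h).eq v
    simpa [hv] using this

theorem convFamily_iota (hA : ∀ i j, A i j = A j i) (a j : Fin m) {v : Fin N → ℂ}
    (hv : v ∈ kerZero A j) :
    convFamily A μ E a (iota j v) = iota j (shiftedFamily A μ E {j.succ} a v) := by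
  apply curry_injective
  rw [convFamily, curry_residue_conv μ hA, curry_iota, curry_iota,
    convEnd_tupleOn_singleton hv]
  rfl

/-- The diagonal embedding `∑_j ι_j` of `ℂ^N` into `ℂ^{(n-1)N}`. -/
def iotaSum (m N : ℕ) : (Fin N → ℂ) →ₗ[ℂ] (Fin m × Fin N → ℂ) :=
  (LinearEquiv.curry ℂ ℂ (Fin m) (Fin N)).symm.toLinearMap ∘ₗ
    tupleOn N (Finset.univ : Finset (Fin (m + 1)))

theorem curry_iotaSum (v : Fin N → ℂ) :
    Function.curry (iotaSum m N v) = tupleOn N Finset.univ v := rfl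

theorem iotaSum_injective (hm : 1 ≤ m) : Function.Injective (iotaSum m N) := by
  intro v w h
  have h' := congrFun (congrArg Function.curry h) ⟨0, hm⟩
  simpa [curry_iotaSum, tupleOn_apply] using h'

theorem mem_kerInfty (hA : IsKZType A) {v : Fin N → ℂ} :
    v ∈ kerInfty A μ ↔ ∑ j, zeroEnd A j v + μ • v = 0 := by
  have h : Matrix.toLin' (residueInfty A 0 - μ • (1 : Matrix (Fin N) (Fin N) ℂ)) v =
      -(∑ j, zeroEnd A j v + μ • v) := by
    rw [residueInfty, Fin.sum_univ_succ, hA.diag 0, zero_add]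
    simp only [map_sub, map_neg, map_sum, map_smul, LinearMap.sub_apply, LinearMap.neg_apply,
      LinearMap.sum_apply, LinearMap.smul_apply, Matrix.toLin'_one, LinearMap.id_apply, zeroEnd]
    abel
  rw [kerInfty, LinearMap.mem_ker, h, neg_eq_zero]

theorem sumZero_tupleOn_univ (v : Fin N → ℂ) :
    sumZero A Finset.univ (tupleOn N Finset.univ v) = ∑ j, zeroEnd A j v := by
  simp [sumZero_tupleOn]

theorem convEnd_tupleOn_univ_of_notMem (hA : ∀ i j, A i j = A j i)
    {I : Finset (Fin (m + 1))} (h0 : 0 ∉ I) (v : Fin N → ℂ) :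
    convEnd A μ I (tupleOn N Finset.univ v) = tupleOn N Finset.univ (downEnd A I v) := by
  funext r
  by_cases hr : r.succ ∈ I
  · rw [convEnd_of_mem A μ hr, upEnd_eq μ hA, commonRow, if_neg h0, if_neg h0,
      LinearMap.neg_apply, sumZero_tupleOn]
    simp [tupleOn_apply]
  · rw [convEnd_of_notMem A μ hr]
    simp [tupleOn_apply]

theorem convEnd_tupleOn_univ (hA : IsKZType A) {v : Fin N → ℂ} (hv : v ∈ kerInfty A μ)
    (I : Finset (Fin (m + 1))) :
    convEnd A μ I (tupleOn N Finset.univ v) = tupleOn N Finset.univ (downEnd A I v) := by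
  by_cases h0 : 0 ∈ I
  · rw [mem_kerInfty hA] at hv
    funext r
    by_cases hr : r.succ ∈ I
    · rw [convEnd_of_mem A μ hr, upEnd_eq μ hA.symm, commonRow, if_pos h0, if_pos h0,
        sumZero_tupleOn]
      simp only [tupleOn_apply, Finset.mem_univ, if_true, Finset.filter_true]
      rw [← Finset.sum_add_sum_compl (tail I)] at hv
      have h1 := congrArg (fun u => downEnd A I v + u) hv
      simp only [add_zero] at h1
      refine Eq.trans ?_ h1
      abel
    · rw [convEnd_of_notMem A μ hr]
      simp [tupleOn_apply]
  · exact convEnd_tupleOn_univ_of_notMem hA.symm h0 v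

/-- On `ker (A_{0∞} - μ)`, where `∑_j A_{0j} + μ` vanishes, all matrices `A_I^K` with `K = L_n` act by
`A_{I ∖ {0}}`. -/
theorem shifted_univ_apply (hA : IsKZType A) {v : Fin N → ℂ} (hv : v ∈ kerInfty A μ)
    (I : Finset (Fin (m + 1))) :
    Matrix.toLin' (shifted A μ Finset.univ I) v = downEnd A I v := by
  rw [toLin'_shifted]
  split_ifs with h
  · rw [mem_kerInfty hA] at hv
    have hI : I = Finset.univ := Finset.univ_subset_iff.1 h
    rw [upEnd_eq μ hA.symm, hI, if_pos (Finset.mem_univ 0), add_assoc]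
    have : tail (Finset.univ : Finset (Fin (m + 1))) = Finset.univ := by ext; simp
    rw [this, hv, add_zero]
  · rfl

theorem IsKZType.isInvariant_kerInfty (hA : IsKZType A) (μ : ℂ)
    (E : Fin m → Finset (Fin (m + 1))) :
    IsInvariant (shiftedFamily A μ E Finset.univ) (kerInfty A μ) := by
  intro a v hv
  rw [shiftedFamily, shifted_univ_apply hA hv]
  have h0 : (0 : Fin (m + 1)) ∉ (E a).erase 0 := Finset.notMem_erase _ _
  have hd : downEnd A ((E a).erase 0) = downEnd A (E a) := by simp [downEnd]
  have h1 := hA.sumZero_convEnd μ (X := Finset.univ)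
    (Or.inr ⟨h0, Finset.subset_univ (tail ((E a).erase 0))⟩) (tupleOn N Finset.univ v)
  rw [convEnd_tupleOn_univ_of_notMem hA.symm h0, sumZero_tupleOn_univ, sumZero_tupleOn_univ,
    hd] at h1
  rw [mem_kerInfty hA] at hv ⊢
  rw [h1, ← map_smul, ← map_add, hv, map_zero]

theorem convFamily_iotaSum (hA : IsKZType A) (a : Fin m) {v : Fin N → ℂ}
    (hv : v ∈ kerInfty A μ) :
    convFamily A μ E a (iotaSum m N v) =
      iotaSum m N (shiftedFamily A μ E Finset.univ a v) := by
  apply curry_injective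
  rw [convFamily, curry_residue_conv μ hA.symm, curry_iotaSum, curry_iotaSum,
    convEnd_tupleOn_univ hA hv, shiftedFamily, shifted_univ_apply hA hv]

theorem mem_KInfty {w : Fin m × Fin N → ℂ} : w ∈ KInfty A μ ↔
    ∀ r, sumZero A Finset.univ (Function.curry w) + μ • Function.curry w r = 0 := by
  have h : ∀ r, Function.curry (Matrix.toLin' (residueInfty (conv A μ) 0) w) r =
      -(sumZero A Finset.univ (Function.curry w) + μ • Function.curry w r) := by
    intro r
    have h00 : conv A μ 0 0 = 0 := rfl
    have hneg : ∀ u : Fin m × Fin N → ℂ, Function.curry (-u) r = -Function.curry u r :=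
      fun _ => rfl
    have hsum : Function.curry ((∑ j : Fin m, conv A μ 0 j.succ) *ᵥ w) r =
        ∑ j : Fin m, Function.curry (conv A μ 0 j.succ *ᵥ w) r := by
      rw [Matrix.sum_mulVec]
      ext s
      simp [Function.curry, Finset.sum_apply]
    rw [Matrix.toLin'_apply, residueInfty, Fin.sum_univ_succ, h00, zero_add, Matrix.neg_mulVec,
      hneg, hsum, Finset.sum_congr rfl fun j _ => curry_conv_zero_succ A μ j w r,
      Finset.sum_ite_eq, if_pos (Finset.mem_univ r), sumZero_apply]
    rfl
  rw [KInfty, LinearMap.mem_ker]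
  constructor
  · intro hw r
    rw [← neg_eq_zero, ← h r, hw]
    rfl
  · intro hw
    apply curry_injective
    funext r
    rw [h r, hw r, neg_zero]
    rfl

theorem map_iotaSum_kerInfty (hA : IsKZType A) (hμ : μ ≠ 0) :
    (kerInfty A μ).map (iotaSum m N) = KInfty A μ := by
  apply le_antisymm
  · rintro _ ⟨v, hv, rfl⟩
    rw [mem_KInfty]
    intro r
    rw [curry_iotaSum, sumZero_tupleOn_univ, tupleOn_apply, if_pos (Finset.mem_univ _)]
    exact (mem_kerInfty hA).1 hv
  · intro w hw
    rw [mem_KInfty] at hw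
    set v := -(μ⁻¹ • sumZero A Finset.univ (Function.curry w)) with hv
    have hrow : Function.curry w = tupleOn N Finset.univ v := by
      funext r
      have h1 : μ • Function.curry w r = -sumZero A Finset.univ (Function.curry w) :=
        eq_neg_of_add_eq_zero_right (hw r)
      rw [tupleOn_apply, if_pos (Finset.mem_univ _), hv, ← smul_neg, ← h1, smul_smul,
        inv_mul_cancel₀ hμ, one_smul]
    refine ⟨v, (mem_kerInfty hA).2 ?_, curry_injective (hrow ▸ curry_iotaSum v)⟩
    rw [← sumZero_tupleOn_univ, ← hrow, hv, smul_neg, smul_smul, mul_inv_cancel₀ hμ, one_smul,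
      add_neg_cancel]

/-- The sum of the embeddings of the kernels `ker A_{0j}` and `ker (A_{0∞} - μ)`. -/
def kernelSum (A : Fin (m + 1) → Fin (m + 1) → Matrix (Fin N) (Fin N) ℂ) (μ : ℂ) :
    ((∀ j, kerZero A j) × kerInfty A μ) →ₗ[ℂ] (Fin m × Fin N → ℂ) :=
  (∑ j, iota j ∘ₗ (kerZero A j).subtype ∘ₗ LinearMap.proj j).coprod
    (iotaSum m N ∘ₗ (kerInfty A μ).subtype)

theorem kernelSum_apply (x : (∀ j, kerZero A j) × kerInfty A μ) :
    kernelSum A μ x = ∑ j, iota j (x.1 j : Fin N → ℂ) + iotaSum m N x.2 := by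
  simp [kernelSum]

theorem range_kernelSum (hA : IsKZType A) (hμ : μ ≠ 0) :
    LinearMap.range (kernelSum A μ) = KTotal A μ := by
  apply le_antisymm
  · rintro _ ⟨x, rfl⟩
    rw [kernelSum_apply]
    refine Submodule.add_mem _ (Submodule.sum_mem _ fun j _ => ?_) ?_
    · exact Submodule.mem_sup_right (Submodule.mem_iSup_of_mem j ⟨_, (x.1 j).2, rfl⟩)
    · refine Submodule.mem_sup_left ?_
      rw [← map_iotaSum_kerInfty hA hμ]
      exact ⟨_, x.2.2, rfl⟩
  · refine sup_le ?_ (iSup_le fun j => ?_)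
    · rw [← map_iotaSum_kerInfty hA hμ]
      rintro _ ⟨v, hv, rfl⟩
      exact ⟨(0, ⟨v, hv⟩), by simp [kernelSum_apply]⟩
    · rintro _ ⟨v, hv, rfl⟩
      refine ⟨(Pi.single j ⟨v, hv⟩, 0), ?_⟩
      rw [kernelSum_apply, Finset.sum_eq_single j]
      · simp
      · intro k _ hk
        simp [hk]
      · simp

/-- For `μ ≠ 0` the sum of the kernels is direct: in a relation `x_j + v = 0` for all `j` the
vector `v` is annihilated by all `A_{0j}` and by `∑_j A_{0j} + μ`. -/
theorem kernelSum_injective (hA : IsKZType A) (hμ : μ ≠ 0) :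
    Function.Injective (kernelSum A μ) := by
  rw [injective_iff_map_eq_zero]
  rintro ⟨x, v⟩ hx
  have hrow : ∀ r, (x r : Fin N → ℂ) + v = 0 := by
    intro r
    have h1 : Function.curry (kernelSum A μ (x, v)) r = x r + v := by
      have hsum : Function.curry (∑ j, iota j (x j : Fin N → ℂ)) r =
          ∑ j, Function.curry (iota j (x j : Fin N → ℂ)) r := by
        ext s
        simp [Function.curry, Finset.sum_apply]
      have hadd : ∀ u v : Fin m × Fin N → ℂ,
          Function.curry (u + v) r = Function.curry u r + Function.curry v r := fun _ _ => rfl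
      rw [kernelSum_apply, hadd, hsum, curry_iotaSum, tupleOn_apply,
        if_pos (Finset.mem_univ _), Finset.sum_eq_single r]
      · rw [curry_iota, tupleOn_apply, if_pos (Finset.mem_singleton_self _)]
      · intro j _ hj
        rw [curry_iota, tupleOn_apply, if_neg]
        simpa using hj.symm
      · simp
    rw [← h1, hx]
    rfl
  have hv0 : (v : Fin N → ℂ) = 0 := by
    have hz : ∀ r, zeroEnd A r (v : Fin N → ℂ) = 0 := by
      intro r
      rw [eq_neg_of_add_eq_zero_right (hrow r), map_neg, mem_kerZero.1 (x r).2, neg_zero]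
    have h2 := (mem_kerInfty hA).1 v.2
    rw [Finset.sum_eq_zero fun r _ => hz r, zero_add] at h2
    exact (smul_eq_zero.1 h2).resolve_left hμ
  refine Prod.ext (funext fun r => Subtype.ext ?_) (Subtype.ext hv0)
  have := hrow r
  rwa [hv0, add_zero] at this

/-- The spectrum of the middle convolution: the sum of the kernels is the direct product of the
kernels `ker A_{0j}` and `ker (A_{0∞} - μ)`, on which the family acts by the matrices `A_I^K`
for `K = {j}` and `K = L_n`, and multiplicities are additive. -/
theorem IsKZType.simSpec_quotientFamily (hA : IsKZType A) (hμ : μ ≠ 0)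
    (hc : ∀ a a', Commute (convFamily A μ E a) (convFamily A μ E a')) :
    ∃ (hK : IsInvariant (convFamily A μ E) (KTotal A μ))
      (hj : ∀ j : Fin m, IsInvariant (shiftedFamily A μ E {j.succ}) (kerZero A j))
      (hi : IsInvariant (shiftedFamily A μ E Finset.univ) (kerInfty A μ)),
      (∀ a a', Commute (quotientFamily _ _ hK a) (quotientFamily _ _ hK a')) ∧
      ∀ z : Fin m → ℂ, simSpec (convFamily A μ E) z = simSpec (quotientFamily _ _ hK) z +
        (∑ j, simSpec (restrictFamily _ _ (hj j)) z + simSpec (restrictFamily _ _ hi) z) := by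
  have hj := hA.isInvariant_kerZero μ E
  have hi := hA.isInvariant_kerInfty μ E
  let D₁ : Fin m → End ℂ (∀ j, kerZero A j) := fun a =>
    LinearMap.pi fun j => restrictFamily _ _ (hj j) a ∘ₗ LinearMap.proj j
  let D₂ : Fin m → End ℂ (kerInfty A μ) := restrictFamily _ _ hi
  let D : Fin m → End ℂ ((∀ j, kerZero A j) × kerInfty A μ) := fun a => (D₁ a).prodMap (D₂ a)
  have hD : ∀ a x, convFamily A μ E a (kernelSum A μ x) = kernelSum A μ (D a x) := by
    intro a x
    rw [kernelSum_apply, kernelSum_apply, map_add, map_sum,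
      convFamily_iotaSum hA a x.2.2,
      Finset.sum_congr rfl fun j _ => convFamily_iota hA.symm a j (x.1 j).2]
    rfl
  have hK : IsInvariant (convFamily A μ E) (KTotal A μ) := by
    rw [← range_kernelSum hA hμ]
    rintro a _ ⟨x, rfl⟩
    exact ⟨D a x, (hD a x).symm⟩
  have hcD : ∀ a a', Commute (D a) (D a') := fun a a' =>
    commute_of_injective (kernelSum_injective hA hμ) (hD a) (hD a') (hc a a')
  have hcD₁ : ∀ a a', Commute (D₁ a) (D₁ a') := fun a a' =>
    commute_of_surjective (f := LinearMap.fst ℂ (∀ j, kerZero A j) (kerInfty A μ))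
      LinearMap.fst_surjective (fun _ => rfl) (fun _ => rfl) (hcD a a')
  refine ⟨hK, hj, hi, fun a a' => commute_of_surjective (f := (KTotal A μ).mkQ)
    (KTotal A μ).mkQ_surjective (fun _ => rfl) (fun _ => rfl) (hc a a'), fun z => ?_⟩
  have h1 : simSpec (convFamily A μ E) z =
      simSpec D z + simSpec (quotientFamily _ _ hK) z := by
    refine simSpec_add_of_exact hc (kernelSum_injective hA hμ) (KTotal A μ).mkQ_surjective
      (fun y => ?_) hD (fun _ _ => rfl) z
    rw [Submodule.mkQ_apply, Submodule.Quotient.mk_eq_zero, ← range_kernelSum hA hμ]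
    rfl
  have h2 : simSpec D z = simSpec D₁ z + simSpec D₂ z := by
    refine simSpec_add_of_exact hcD
      (f := LinearMap.inl ℂ (∀ j, kerZero A j) (kerInfty A μ))
      (g := LinearMap.snd ℂ (∀ j, kerZero A j) (kerInfty A μ)) LinearMap.inl_injective
      LinearMap.snd_surjective (fun y => ?_) (fun a x => ?_) (fun _ _ => rfl) z
    · constructor
      · intro hy
        exact ⟨y.1, Prod.ext rfl (Eq.symm hy)⟩
      · rintro ⟨x, rfl⟩
        rfl
    · exact Prod.ext rfl (map_zero (D₂ a))
  have h3 : simSpec D₁ z = ∑ j, simSpec (restrictFamily _ _ (hj j)) z :=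
    simSpec_of_isTriangular hcD₁ (fun a w k _ => rfl) z
  rw [h1, h2, h3, add_comm]

end Kernels

end KZ

end

theorem mainTheorem1 {m N : ℕ} (hm : 1 ≤ m) (hN : 1 ≤ N)
    (A : Fin (m + 1) → Fin (m + 1) → Matrix (Fin N) (Fin N) ℂ) (hA : KZ.IsKZType A) (μ : ℂ)
    (F : Finset (Finset (Fin (m + 1)))) (hF : KZ.IsMaxCommutingFamily F)
    (E : Fin m → Finset (Fin (m + 1))) (hE : KZ.IsOrdering F E) :
    -- the spectrum of a single residue matrix
    (∀ I ∈ F, KZ.IsSpecUnion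
      (fun _ : Unit => Matrix.toLin' (KZ.residue (KZ.conv A μ) I))
      (![fun _ => Matrix.toLin' (KZ.residue A (insert 0 I) +
            (if 0 ∈ I then μ else 0) • (1 : Matrix (Fin N) (Fin N) ℂ)),
        fun _ => Matrix.toLin' (KZ.residue A (I.erase 0))] :
          Fin 2 → Unit → Module.End ℂ (Fin N → ℂ))
      ![I.card - 1, m + 1 - I.card]) ∧
    -- the simultaneous spectrum of the family
    KZ.IsSpecUnion (KZ.convFamily A μ E)
      (fun a : Fin m => KZ.shiftedFamily A μ E (E a)) (fun _ => 1) ∧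
    -- its restrictions to the kernels
    (∀ j : Fin m, KZ.SameSpectrumOn (KZ.convFamily A μ E) (KZ.KSub A j)
      (KZ.shiftedFamily A μ E {j.succ}) (KZ.kerZero A j)) ∧
    (μ ≠ 0 → KZ.SameSpectrumOn (KZ.convFamily A μ E) (KZ.KInfty A μ)
      (KZ.shiftedFamily A μ E Finset.univ) (KZ.kerInfty A μ)) ∧
    -- simultaneous block upper triangularization
    (∀ b, KZ.IsLosingSide F b →
      IsUnit (KZ.basisChange N E b) ∧
      ∀ a, ((KZ.basisChange N E b)⁻¹ * KZ.residue (KZ.conv A μ) (E a) *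
        KZ.basisChange N E b).BlockTriangular Prod.fst) ∧
    -- the simultaneous spectrum of the middle convolution
    (μ ≠ 0 → ∃ (hK : KZ.IsInvariant (KZ.convFamily A μ E) (KZ.KTotal A μ))
      (hj : ∀ j : Fin m, KZ.IsInvariant (KZ.shiftedFamily A μ E {j.succ}) (KZ.kerZero A j))
      (hi : KZ.IsInvariant (KZ.shiftedFamily A μ E Finset.univ) (KZ.kerInfty A μ)),
      (∀ a a', Commute (KZ.quotientFamily _ _ hK a) (KZ.quotientFamily _ _ hK a')) ∧
      ∀ z : Fin m → ℂ,
        KZ.simSpec (KZ.quotientFamily _ _ hK) z +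
            (∑ j, KZ.simSpec (KZ.restrictFamily _ _ (hj j)) z +
              KZ.simSpec (KZ.restrictFamily _ _ hi) z) =
          ∑ a, KZ.simSpec (KZ.shiftedFamily A μ E (E a)) z) ∧
    -- the tournaments on the right: team `0` is deleted and inserted again
    (∀ J, (J ∈ F ∨ ∃ j : Fin m, J = {j.succ}) →
      KZ.IsMaxCommutingFamily (KZ.insertTeam 0 (J.erase 0) (KZ.deleteTeam 0 F)) ∧
      KZ.insertTeam 0 (J.erase 0) (KZ.deleteTeam 0 F) =
        (F.image (KZ.md 0 J) ∪ {insert 0 J, J.erase 0}).filter fun I => 1 < I.card) := by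
  have hcard : 1 < Fintype.card (Fin (m + 1)) := by rw [Fintype.card_fin]; omega
  have huniv := hF.univ_mem hcard
  have hmem : ∀ k, E k ∈ F := fun k => (hE.mem_iff _).2 ⟨k, rfl⟩
  have hc := hA.commute_convFamily μ hF.prop hmem
  have hunion := hA.isSpecUnion_convFamily μ hF huniv hE
  refine ⟨fun I hI => KZ.isSpecUnion_residue_conv hA.symm μ (hF.prop.node_nonempty (Or.inl hI)),
    hunion, fun j => ?_, fun hμ => ?_, fun b hb => ?_, fun hμ => ?_, fun J hJ => ?_⟩
  · exact KZ.sameSpectrumOn_map hc (KZ.iota_injective j) (hA.isInvariant_kerZero μ E j)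
      fun a _ hv => KZ.convFamily_iota hA.symm a j hv
  · rw [← KZ.map_iotaSum_kerInfty hA hμ]
    exact KZ.sameSpectrumOn_map hc (KZ.iotaSum_injective hm) (hA.isInvariant_kerInfty μ E)
      fun a _ hv => KZ.convFamily_iotaSum hA a hv
  · exact ⟨KZ.isUnit_basisChange hb hF.prop huniv hE,
      fun a => KZ.blockTriangular_basisChange hA.symm hb hF.prop huniv hE a⟩
  · obtain ⟨hK, hj, hi, hcomm, hspec⟩ := hA.simSpec_quotientFamily hμ hc
    refine ⟨hK, hj, hi, hcomm, fun z => ?_⟩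
    rw [← hspec z, hunion.mult z]
    simp
  · have hJnode : KZ.IsNode F J := hJ.imp id fun ⟨j, hj⟩ => ⟨j.succ, hj⟩
    have hJ0 : (J.erase 0).Nonempty := by
      rcases hJ with hJ | ⟨j, rfl⟩
      · have h1 := hF.prop.1 J hJ
        have h2 := Finset.pred_card_le_card_erase (s := J) (a := 0)
        exact Finset.card_pos.1 (by omega)
      · exact ⟨j.succ, by simp⟩
    rw [hF.prop.insertTeam_deleteTeam hJnode hJ0]
    exact ⟨hF.moveTeam hcard hJnode hJ0, rfl⟩
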